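/- Let $X=\mathcal{A}$ be the rack of all transpositions in the symmetric group $\mathbb{S}_4$, with $\sigma\triangleright\tau=\sigma\tau\sigma^{-1}$, labelled $\pi_1=(3\,4)$, $\pi_2=(2\,3)$, $\pi_3=(2\,4)$, $\pi_4=(1\,2)$, $\pi_5=(1\,3)$, $\pi_6=(1\,4)$. Let $G_X$ be its enveloping group, that is, the group with generators $x_i$ ($1\le i\le 6$) and relations $x_ix_jx_i^{-1}=x_{k}$ whenever $\pi_i\triangleright\pi_j=\pi_k$. Let $\Bbbk$ be an arbitrary field and let $\rho$ be an absolutely simple representation over $\Bbbk$ of the centralizer $C_{G_X}(x_1)$ (which contains $x_4$). Let $V=M(x_1,\rho)=\mathrm{Ind}_{C_{G_X}(x_1)}^{G_X}\rho$, a Yetter-Drinfeld module over $\Bbbk G_X$ with coaction $\delta(h\otimes w)=hx_1h^{-1}\otimes(h\otimes w)$; put $d_V=\dim V$ and $V_g=\{v\in V\mid\delta(v)=g\otimes v\}$ for $g\in G_X$. Let $\mathfrak{B}(V)=\bigoplus_{n\ge0}\mathfrak{B}_n(V)$ be the Nichols algebra of $V$, and let $(n)_t=1+t+\cdots+t^{n-1}$.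 1. The representation $\rho$ is a linear character of $C_{G_X}(x_1)$, hence $d_V=6$. Moreover, $\dim\mathfrak{B}_2(V)\le d_V(d_V+1)/2$ if and only if $\rho(x_1)=-1$. In this case $\rho(x_4)\in\{-1,1\}$. 2. Assume that $\rho(x_1)=-1$. Then: (a) the Hilbert series of $\mathfrak{B}(V)$ is $\sum_{n\ge0}\dim\mathfrak{B}_n(V)\,t^n=(2)_t^2(3)_t^2(4)_t^2$, and $\dim\mathfrak{B}(V)=576$; (b) if $v_i\in V_{x_i}$ ($1\le i\le6$) are non-zero elements, then the monomial $v_1v_2v_1v_3v_4v_2v_1v_3v_4v_5v_1v_6$ is an integral of $\mathfrak{B}(V)$, that is, a non-zero element $\Lambda$ with $b\Lambda=\varepsilon(b)\Lambda=\Lambda b$ for all $b\in\mathfrak{B}(V)$, where $\varepsilon$ is the counit. -/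

import Mathlib

open scoped TensorProduct

universe u v

noncomputable section

namespace NicholsA

/-! ### Racks and enveloping groups -/

/-- The conjugacy class of `g` in a group `G`. -/
def ConjClass {G : Type*} [Group G] (g : G) : Type _ := {h : G // IsConj g h}

/-- A conjugacy class is a rack with `x ◃ y = x y x⁻¹`. -/
instance conjClassRack {G : Type*} [Group G] (g : G) : Rack (ConjClass g) where
  act x y := ⟨x.1 * y.1 * x.1⁻¹, y.2.trans (isConj_iff.2 ⟨x.1, rfl⟩)⟩
  self_distrib := by
    intro x y z
    apply Subtype.ext
    simp only [mul_inv_rev, inv_inv]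
    group
  invAct x y := ⟨x.1⁻¹ * y.1 * x.1, y.2.trans (isConj_iff.2 ⟨x.1⁻¹, by simp⟩)⟩
  left_inv := by
    intro x y
    apply Subtype.ext
    simp only
    group
  right_inv := by
    intro x y
    apply Subtype.ext
    simp only
    group

/-- The rack `𝒜`: the conjugacy class of the transposition `(1 2)` in the symmetric group on four
letters.  The letters `1, 2, 3, 4` are the elements `0, 1, 2, 3` of `Fin 4`. -/
abbrev RackA : Type := ConjClass (Equiv.swap (0 : Fin 4) 1)

/-- The transposition exchanging `a` and `b`, as an element of `𝒜`. -/
def transp (a b : Fin 4) (h : a ≠ b) : RackA :=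
  ⟨Equiv.swap a b, Equiv.Perm.isConj_swap (by decide) h⟩

/-- `π₁ = (3 4)` -/
def π₁ : RackA := transp 2 3 (by decide)
/-- `π₂ = (2 3)` -/
def π₂ : RackA := transp 1 2 (by decide)
/-- `π₃ = (2 4)` -/
def π₃ : RackA := transp 1 3 (by decide)
/-- `π₄ = (1 2)` -/
def π₄ : RackA := transp 0 1 (by decide)
/-- `π₅ = (1 3)` -/
def π₅ : RackA := transp 0 2 (by decide)
/-- `π₆ = (1 4)` -/
def π₆ : RackA := transp 0 3 (by decide)

/-- The enveloping group `G_X` of the rack `X = 𝒜`, generated by the `gen i`, `i ∈ X`, subject to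
the relations `gen i * gen j * (gen i)⁻¹ = gen (i ◃ j)`. -/
abbrev GA : Type := Rack.EnvelGroup RackA

/-- The generator `x_i` of the enveloping group attached to `i ∈ 𝒜`. -/
def gen (i : RackA) : GA := Rack.toEnvelGroup RackA i

/-- `x₁` as an element of its own centralizer. -/
def c₁ : Subgroup.centralizer {gen π₁} :=
  ⟨gen π₁, Subgroup.mem_centralizer_singleton_iff.2 rfl⟩

theorem gen₄_mem : gen π₄ ∈ Subgroup.centralizer {gen π₁} := by
  rw [Subgroup.mem_centralizer_singleton_iff]
  have h1 : Shelf.act π₁ π₄ = π₄ := Subtype.ext (by decide)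
  have h2 : gen (Shelf.act π₁ π₄) = gen π₁ * gen π₄ * (gen π₁)⁻¹ :=
    (Rack.toEnvelGroup RackA).map_act'
  rw [h1] at h2
  rw [eq_mul_inv_iff_mul_eq] at h2
  exact h2

/-- `x₄` as an element of the centralizer of `x₁`. -/
def c₄ : Subgroup.centralizer {gen π₁} := ⟨gen π₄, gen₄_mem⟩

/-! ### Absolutely simple representations -/

/-- Extension of scalars of a representation from `k` to `K`. -/
def baseChangeRep {k : Type u} [Field k] {G : Type*} [Group G] {W : Type*} [AddCommGroup W]
    [Module k W] (K : Type u) [Field K] [Algebra k K] (ρ : Representation k G W) :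
    Representation K G (K ⊗[k] W) where
  toFun g := (ρ g).baseChange K
  map_one' := by simp [Module.End.one_eq_id]
  map_mul' g h := by simp [Module.End.mul_eq_comp, LinearMap.baseChange_comp]

/-- A representation over `k` is absolutely simple if it stays irreducible over every field
extension of `k`. -/
def IsAbsolutelySimple {k : Type u} [Field k] {G : Type*} [Group G] {W : Type*} [AddCommGroup W]
    [Module k W] (ρ : Representation k G W) : Prop :=
  ∀ (K : Type u) [Field K] [Algebra k K], (baseChangeRep K ρ).IsIrreducible

/-! ### Yetter-Drinfeld modules -/

/-- A (left-left) Yetter-Drinfeld module structure over the group algebra `kG` on `V`.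
The coaction takes values in `kG ⊗ V`, written as finitely supported functions `G →₀ V`;
`coact v = ∑ h, single h (coact v h)` stands for `δ v = ∑ h, h ⊗ (coact v h)`. -/
structure YetterDrinfeld (k G V : Type*) [Field k] [Group G] [AddCommGroup V] [Module k V] where
  /-- the action of `G` -/
  rep : Representation k G V
  /-- the coaction of `kG` -/
  coact : V →ₗ[k] (G →₀ V)
  counit_coact : ∀ v, (coact v).sum (fun _ m => m) = v
  coassoc : ∀ v h, coact (coact v h) = Finsupp.single h (coact v h)
  coact_rep : ∀ g v h, coact (rep g v) (g * h * g⁻¹) = rep g (coact v h)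

namespace YetterDrinfeld

variable {k G V : Type*} [Field k] [Group G] [AddCommGroup V] [Module k V]
  (Y : YetterDrinfeld k G V)

/-- `V_g = {v ∈ V | δ v = g ⊗ v}` -/
def component (g : G) : Submodule k V where
  carrier := {v | Y.coact v = Finsupp.single g v}
  add_mem' {a b} ha hb := by
    simp only [Set.mem_ofPred_eq] at ha hb ⊢
    rw [map_add, ha, hb, Finsupp.single_add]
  zero_mem' := by simp
  smul_mem' c a ha := by
    simp only [Set.mem_ofPred_eq] at ha ⊢
    rw [map_smul, ha, Finsupp.smul_single]

/-! ### The tensor algebra of a Yetter-Drinfeld module -/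

/-- The action of `g` on the tensor algebra `TV` by algebra endomorphisms. -/
def tensorAct (g : G) : TensorAlgebra k V →ₐ[k] TensorAlgebra k V :=
  TensorAlgebra.lift k (TensorAlgebra.ι k ∘ₗ Y.rep g)

/-- The coaction of `kG` on the tensor algebra, an algebra map to `kG ⊗ TV`, the latter written
as the algebra of finite formal combinations of elements of `G` with coefficients in `TV`. -/
def tensorCoact : TensorAlgebra k V →ₐ[k] MonoidAlgebra (TensorAlgebra k V) G :=
  TensorAlgebra.lift k ((MonoidAlgebra.coeffLinearEquiv k).symm.toLinearMap ∘ₗ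
    Finsupp.mapRange.linearMap (TensorAlgebra.ι k) ∘ₗ Y.coact)

/-- Left multiplication by `v ⊗ 1 + 1 ⊗ v`, `v ∈ V`, on the braided tensor product algebra
`TV ⊗ TV`, whose product is `(a ⊗ b)(c ⊗ d) = a (b₍₋₁₎ · c) ⊗ b₍₀₎ d`.  Explicitly,
`a ⊗ b ↦ v a ⊗ b + ∑ h, (h · a) ⊗ v_h b`, where `δ v = ∑ h, h ⊗ v_h`. -/
def mulPrimitive : V →ₗ[k] Module.End k (TensorAlgebra k V ⊗[k] TensorAlgebra k V) :=
  (LinearMap.rTensorHom (TensorAlgebra k V) ∘ₗ LinearMap.mul k (TensorAlgebra k V) ∘ₗ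
      TensorAlgebra.ι k) +
    (Finsupp.lsum k fun h : G =>
      TensorProduct.mapBilinear (RingHom.id k) (TensorAlgebra k V) (TensorAlgebra k V)
          (TensorAlgebra k V) (TensorAlgebra k V) (Y.tensorAct h).toLinearMap ∘ₗ
        LinearMap.mul k (TensorAlgebra k V) ∘ₗ TensorAlgebra.ι k) ∘ₗ Y.coact

/-- The braided coproduct `Δ : TV → TV ⊗ TV`: the algebra map to the braided tensor product
algebra with `Δ v = v ⊗ 1 + 1 ⊗ v` for `v ∈ V`.  So `Δ (v₁ ⋯ vₙ)` is obtained from `1 ⊗ 1` by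
successive left multiplications by the `vᵢ ⊗ 1 + 1 ⊗ vᵢ`. -/
def comul : TensorAlgebra k V →ₗ[k] TensorAlgebra k V ⊗[k] TensorAlgebra k V :=
  LinearMap.applyₗ (1 ⊗ₜ[k] 1) ∘ₗ (TensorAlgebra.lift k Y.mulPrimitive).toLinearMap

theorem comul_one : Y.comul 1 = 1 ⊗ₜ[k] 1 := by
  simp [comul]

theorem comul_ι_mul (v : V) (t : TensorAlgebra k V) :
    Y.comul (TensorAlgebra.ι k v * t) = Y.mulPrimitive v (Y.comul t) := by
  simp [comul]

theorem mulPrimitive_tmul (v : V) (a b : TensorAlgebra k V) :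
    Y.mulPrimitive v (a ⊗ₜ[k] b) = (TensorAlgebra.ι k v * a) ⊗ₜ[k] b +
      (Y.coact v).sum fun h m => Y.tensorAct h a ⊗ₜ[k] (TensorAlgebra.ι k m * b) := by
  simp [mulPrimitive, Finsupp.sum, LinearMap.sum_apply]

/-- The ideals of `TV` that are divided out in pre-Nichols algebras: `ℕ`-graded two-sided ideals
in degrees `≥ 2` that are Yetter-Drinfeld submodules and coideals. -/
structure IsAdmissible (J : Ideal (TensorAlgebra k V)) : Prop where
  isTwoSided : J.IsTwoSided
  graded : ∀ t ∈ J, ∀ n : ℕ, (DirectSum.decompose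
    ((LinearMap.range (TensorAlgebra.ι k : V →ₗ[k] _) ^ ·) : ℕ → Submodule k _) t n :
      TensorAlgebra k V) ∈ J
  degree_ge_two : ∀ t ∈ J, ∀ n : ℕ, n < 2 → (DirectSum.decompose
    ((LinearMap.range (TensorAlgebra.ι k : V →ₗ[k] _) ^ ·) : ℕ → Submodule k _) t n :
      TensorAlgebra k V) = 0
  act_mem : ∀ t ∈ J, ∀ g : G, Y.tensorAct g t ∈ J
  coact_mem : ∀ t ∈ J, ∀ g : G, (Y.tensorCoact t).coeff g ∈ J
  counit_eq_zero : ∀ t ∈ J, TensorAlgebra.algebraMapInv t = 0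
  /-- `Δ J ⊆ J ⊗ TV + TV ⊗ J` -/
  comul_mem : ∀ t ∈ J, TensorProduct.map (J.restrictScalars k).mkQ (J.restrictScalars k).mkQ
    (Y.comul t) = 0

/-! ### The Nichols algebra -/

/-- The defining ideal of the Nichols algebra: the largest admissible ideal of `TV`, that is, the
sum of all of them. -/
def nicholsIdeal : Ideal (TensorAlgebra k V) := sSup {J | Y.IsAdmissible J}

instance nicholsIdeal_isTwoSided : Y.nicholsIdeal.IsTwoSided where
  mul_mem_of_left {a} b ha := by
    have h : Y.nicholsIdeal ≤ Submodule.comap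
        (LinearMap.toSpanSingleton (TensorAlgebra k V) (TensorAlgebra k V) b) Y.nicholsIdeal := by
      refine sSup_le fun J hJ t ht => ?_
      have h1 : t * b ∈ J := hJ.isTwoSided.mul_mem_of_left b ht
      exact (le_sSup hJ : J ≤ Y.nicholsIdeal) h1
    exact h ha

/-- The Nichols algebra `𝔅(V)`. -/
def Nichols : Type _ := TensorAlgebra k V ⧸ Y.nicholsIdeal

instance : Ring Y.Nichols := inferInstanceAs (Ring (TensorAlgebra k V ⧸ Y.nicholsIdeal))

instance : Algebra k Y.Nichols :=
  inferInstanceAs (Algebra k (TensorAlgebra k V ⧸ Y.nicholsIdeal))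

/-- The canonical projection `TV → 𝔅(V)`. -/
def nicholsMk : TensorAlgebra k V →ₐ[k] Y.Nichols := Ideal.Quotient.mkₐ k Y.nicholsIdeal

/-- The canonical map `V → 𝔅(V)`. -/
def toNichols : V →ₗ[k] Y.Nichols := Y.nicholsMk.toLinearMap ∘ₗ TensorAlgebra.ι k

/-- The homogeneous component `𝔅ₙ(V)`, the image of `V^{⊗ n}`. -/
def nicholsDegree (n : ℕ) : Submodule k Y.Nichols :=
  (LinearMap.range (TensorAlgebra.ι k : V →ₗ[k] _) ^ n).map Y.nicholsMk.toLinearMap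

/-- The Hilbert series of `𝔅(V)`, for finite-dimensional `V`. -/
def hilbertSeries : PowerSeries ℤ :=
  PowerSeries.mk fun n => (Module.finrank k (Y.nicholsDegree n) : ℤ)

theorem counit_nicholsIdeal (t : TensorAlgebra k V) (ht : t ∈ Y.nicholsIdeal) :
    (TensorAlgebra.algebraMapInv : TensorAlgebra k V →ₐ[k] k) t = 0 := by
  have h : Y.nicholsIdeal ≤
      RingHom.ker (TensorAlgebra.algebraMapInv : TensorAlgebra k V →ₐ[k] k) :=
    sSup_le fun J hJ t ht => hJ.counit_eq_zero t ht
  exact h ht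

/-- The sum of all admissible ideals is itself admissible. -/
theorem nicholsIdeal_isAdmissible : Y.IsAdmissible Y.nicholsIdeal := by
  have ind : ∀ (p : TensorAlgebra k V → Prop), p 0 → (∀ a b, p a → p b → p (a + b)) →
      (∀ J, Y.IsAdmissible J → ∀ t ∈ J, p t) → ∀ t ∈ Y.nicholsIdeal, p t := by
    intro p h0 ha hJ t ht
    rw [nicholsIdeal, sSup_eq_iSup'] at ht
    exact Submodule.iSup_induction _ (motive := p) ht (fun J t h => hJ J.1 J.2 t h) h0 ha
  have le : ∀ J, Y.IsAdmissible J → J ≤ Y.nicholsIdeal := fun J hJ => le_sSup hJ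
  refine ⟨inferInstance, ?_, ?_, ?_, ?_, Y.counit_nicholsIdeal, ?_⟩
  · refine ind _ (by simp) ?_ (fun J hJ t ht n => le J hJ (hJ.graded t ht n))
    intro a b ha hb n
    rw [DirectSum.decompose_add]
    exact add_mem (ha n) (hb n)
  · refine ind _ (by simp) ?_ (fun J hJ t ht n => hJ.degree_ge_two t ht n)
    intro a b ha hb n hn
    rw [DirectSum.decompose_add]
    simp [ha n hn, hb n hn]
  · refine ind _ (by simp) ?_ (fun J hJ t ht n => le J hJ (hJ.act_mem t ht n))
    intro a b ha hb n
    rw [map_add]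
    exact add_mem (ha n) (hb n)
  · refine ind _ (by simp) ?_ (fun J hJ t ht n => le J hJ (hJ.coact_mem t ht n))
    intro a b ha hb n
    rw [map_add]
    exact add_mem (ha n) (hb n)
  · refine ind _ (by simp) ?_ ?_
    · intro a b ha hb
      rw [map_add, map_add, ha, hb, add_zero]
    · intro J hJ t ht
      have h := hJ.comul_mem t ht
      have hl : J.restrictScalars k ≤ Y.nicholsIdeal.restrictScalars k := le J hJ
      have := congrArg (TensorProduct.map (Submodule.factor hl) (Submodule.factor hl)) h
      rw [map_zero, ← LinearMap.comp_apply, ← TensorProduct.map_comp] at this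
      simpa using this
/-- The counit of `𝔅(V)`. -/
def nicholsCounit : Y.Nichols →ₐ[k] k :=
  Ideal.Quotient.liftₐ Y.nicholsIdeal TensorAlgebra.algebraMapInv Y.counit_nicholsIdeal

theorem nicholsCounit_mk (t : TensorAlgebra k V) :
    Y.nicholsCounit (Y.nicholsMk t) = TensorAlgebra.algebraMapInv t :=
  rfl

theorem nicholsMk_eq_zero (t : TensorAlgebra k V) :
    Y.nicholsMk t = 0 ↔ t ∈ Y.nicholsIdeal :=
  Ideal.Quotient.eq_zero_iff_mem

/-- An integral of `𝔅(V)`: a non-zero element `Λ` with `b Λ = ε(b) Λ = Λ b` for all `b`. -/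
def IsHopfIntegral (Λ : Y.Nichols) : Prop :=
  Λ ≠ 0 ∧ ∀ b : Y.Nichols, b * Λ = Y.nicholsCounit b • Λ ∧ Λ * b = Y.nicholsCounit b • Λ

end YetterDrinfeld

/-! ### The Yetter-Drinfeld modules `M(g, ρ)` -/

theorem single_tmul_eq {k G W : Type*} [Field k] [AddCommGroup W] [Module k W]
    (h : G) (r : k) (w : W) :
    (MonoidAlgebra.single h r : MonoidAlgebra k G) ⊗ₜ[k] w =
      (MonoidAlgebra.single h 1 : MonoidAlgebra k G) ⊗ₜ[k] (r • w) := by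
  rw [← TensorProduct.smul_tmul]; simp

section Induced

variable {k G W : Type*} [Field k] [Group G] [AddCommGroup W] [Module k W] (g : G)
  (ρ : Representation k (Subgroup.centralizer {g}) W)

/-- The underlying space of `M(g, ρ)`, the induced module `kG ⊗_{k C_G(g)} W`.  The element
`h ⊗ w` of the latter is `IndV.mk _ _ h⁻¹ w`. -/
abbrev InducedSpace : Type _ := Representation.IndV (Subgroup.centralizer {g}).subtype ρ

/-- The element `h ⊗ w` of the induced module. -/
def inducedTmul (h : G) : W →ₗ[k] InducedSpace g ρ :=
  Representation.IndV.mk (Subgroup.centralizer {g}).subtype ρ h⁻¹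

theorem indMk_rep (h : G) (c : Subgroup.centralizer {g}) (w : W) :
    Representation.IndV.mk (Subgroup.centralizer {g}).subtype ρ ((c : G) * h) (ρ c w) =
      Representation.IndV.mk (Subgroup.centralizer {g}).subtype ρ h w := by
  have := Representation.Coinvariants.mk_self_apply
    (Representation.tprod ((Representation.leftRegular k G).comp
      (Subgroup.centralizer {g}).subtype) ρ) c (MonoidAlgebra.single h 1 ⊗ₜ[k] w)
  simpa using this

theorem conj_centralizer (h : G) (c : Subgroup.centralizer {g}) :
    ((c : G) * h)⁻¹ * g * ((c : G) * h) = h⁻¹ * g * h := by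
  have hc : (c : G) * g = g * (c : G) := Subgroup.mem_centralizer_singleton_iff.1 c.2
  rw [mul_inv_rev, mul_assoc, ← mul_assoc g, ← hc]; group

/-- The coaction `δ (h ⊗ w) = h g h⁻¹ ⊗ (h ⊗ w)` on the induced module. -/
def inducedCoact : InducedSpace g ρ →ₗ[k] (G →₀ InducedSpace g ρ) :=
  Representation.Coinvariants.lift _
    (TensorProduct.lift ((Finsupp.lsum k fun h : G => LinearMap.toSpanSingleton k
        (W →ₗ[k] (G →₀ InducedSpace g ρ))
        (Finsupp.lsingle (h⁻¹ * g * h) ∘ₗ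
          Representation.IndV.mk (Subgroup.centralizer {g}).subtype ρ h)) ∘ₗ
      (MonoidAlgebra.coeffLinearEquiv k).toLinearMap))
    (by
      intro c
      refine TensorProduct.ext' fun a w => ?_
      induction a using MonoidAlgebra.induction_linear with
      | zero => simp
      | add a b ha hb => rw [TensorProduct.add_tmul, map_add, map_add, ha, hb]
      | single h r =>
        have h2 := indMk_rep g ρ h c (r • w)
        have h1 := conj_centralizer g h c
        rw [single_tmul_eq]
        simp only [mul_inv_rev] at h1
        simp only [map_smul] at h2
        simp only [LinearMap.coe_comp, Function.comp_apply,
          Representation.tprod_apply, TensorProduct.map_tmul, MonoidHom.coe_comp,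
          Subgroup.coe_subtype, TensorProduct.lift.tmul]
        simp
        rw [h1]
        exact congrArg _ h2)

theorem inducedCoact_mk (h : G) (w : W) :
    inducedCoact g ρ (Representation.IndV.mk (Subgroup.centralizer {g}).subtype ρ h w) =
      Finsupp.single (h⁻¹ * g * h)
        (Representation.IndV.mk (Subgroup.centralizer {g}).subtype ρ h w) := by
  simp [inducedCoact]

theorem induced_induction {p : InducedSpace g ρ → Prop} (m : InducedSpace g ρ)
    (zero : p 0) (add : ∀ a b, p a → p b → p (a + b))
    (mk : ∀ h w, p (Representation.IndV.mk (Subgroup.centralizer {g}).subtype ρ h w)) : p m := by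
  obtain ⟨t, rfl⟩ := Representation.Coinvariants.mk_surjective _ m
  induction t using TensorProduct.induction_on with
  | zero => simpa using zero
  | add a b ha hb => rw [map_add]; exact add _ _ ha hb
  | tmul a w =>
    induction a using MonoidAlgebra.induction_linear with
    | zero => simpa using zero
    | add a b ha hb => rw [TensorProduct.add_tmul, map_add]; exact add _ _ ha hb
    | single h r =>
      rw [single_tmul_eq]
      exact mk h (r • w)

/-- The Yetter-Drinfeld module `M(g, ρ) = Ind_{C_G(g)}^G ρ`. -/
def induced : YetterDrinfeld k G (InducedSpace g ρ) where
  rep := Representation.ind (Subgroup.centralizer {g}).subtype ρ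
  coact := inducedCoact g ρ
  counit_coact v := by
    induction v using induced_induction g ρ with
    | zero => simp
    | add a b ha hb =>
      rw [map_add, Finsupp.sum_add_index' (by simp) (by simp), ha, hb]
    | mk h w =>
      rw [inducedCoact_mk, Finsupp.sum_single_index rfl]
  coassoc v h := by
    induction v using induced_induction g ρ with
    | zero => simp
    | add a b ha hb =>
      rw [map_add, Finsupp.add_apply, map_add, ha, hb, Finsupp.single_add]
    | mk h' w =>
      rw [inducedCoact_mk]
      by_cases e : h'⁻¹ * g * h' = h
      · rw [e, Finsupp.single_eq_same, inducedCoact_mk, e]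
      · rw [Finsupp.single_eq_of_ne (Ne.symm e)]; simp
  coact_rep a v h := by
    induction v using induced_induction g ρ with
    | zero => simp
    | add m n hm hn =>
      rw [map_add, map_add, Finsupp.add_apply, hm, hn, map_add, Finsupp.add_apply, map_add]
    | mk h' w =>
      rw [Representation.ind_mk, inducedCoact_mk, inducedCoact_mk]
      have e : (h' * a⁻¹)⁻¹ * g * (h' * a⁻¹) = a * (h'⁻¹ * g * h') * a⁻¹ := by group
      rw [e]
      by_cases e : h'⁻¹ * g * h' = h
      · rw [e, Finsupp.single_eq_same, Finsupp.single_eq_same, Representation.ind_mk]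
      · rw [Finsupp.single_eq_of_ne (Ne.symm e), Finsupp.single_eq_of_ne]
        · simp
        · intro e'
          exact e (by simpa using e'.symm)

theorem induced_rep_tmul (a h : G) (w : W) :
    (induced g ρ).rep a (inducedTmul g ρ h w) = inducedTmul g ρ (a * h) w := by
  simp [induced, inducedTmul]

theorem induced_coact_tmul (h : G) (w : W) :
    (induced g ρ).coact (inducedTmul g ρ h w) =
      Finsupp.single (h * g * h⁻¹) (inducedTmul g ρ h w) := by
  simpa [induced, inducedTmul] using inducedCoact_mk g ρ h⁻¹ w

theorem inducedTmul_rep (h : G) (c : Subgroup.centralizer {g}) (w : W) :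
    inducedTmul g ρ h (ρ c w) = inducedTmul g ρ (h * c) w := by
  have := indMk_rep g ρ (h * c)⁻¹ c w
  simp only [mul_inv_rev, mul_inv_cancel_left] at this
  simpa only [inducedTmul, mul_inv_rev] using this

end Induced

/-- `(n)_t = 1 + t + ⋯ + t^{n-1}` -/
def qInt (n : ℕ) : PowerSeries ℤ := ∑ i ∈ Finset.range n, PowerSeries.X ^ i

end NicholsA

end

/-! The group. The kernel of the projection from `GA` to S₄ is central, and the centralizer of a
transposition in S₄ is a Klein four-group whose elements have commuting lifts. Hence the centralizer
of x₁ is abelian, and an absolutely simple ρ is a character χ (`centralizer_commute`,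
`exists_character`). So V has a basis b_i of degree x_i with x_i b_j = q_ij b_{i▷j} and q_ii = χ(x₁)
(`exists_isLetterBasis`). If χ(x₁) = -1, then x₁² = x₄² forces s = χ(x₄) to be a sign, and after
rescaling the b_i the matrix q is an explicit table of signs depending only on s (`eq_signTable`).

Upper bound. The orbits of the braiding on pairs of letters give 17 quadratic primitive elements of
the tensor algebra. They generate an admissible ideal and so vanish in 𝔅(V)
(`quadraticIdeal_isAdmissible`, `quadraticRelations`). Together with eight consequences of degrees
three, four and six they rewrite every monomial into normal words, those containing none of 25
leading words (`eval_mem_span_normal`). There are 576 normal words, none longer than 12, and their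
lengths are distributed as in the Hilbert series.

Lower bound. Skew derivations preserve the Nichols ideal, so iterating them along a word f gives a
functional on 𝔅(V). Whether it can be non-zero on the monomial of w is bounded by a combinatorial
condition, `reach f w`, which involves neither the field nor q. A finite computation shows that the
pairing of normal words is unitriangular, so their monomials are independent
(`linearIndependent_normal`). Confluence of the rewriting is never needed.

Consequences. A monomial of length 12 that pairs to 1 with itself is non-zero, and it is an integral
because degree 13 vanishes. In degree two, χ(x₁) = -1 gives dimension 36 - 17 = 19 ≤ 21; otherwise
the six squares are independent of the 19 normal words and the dimension is at least 25. -/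

noncomputable section

namespace NicholsA

/-! ### Linear functionals in degree one -/

section Tensor

variable {k V : Type*} [Field k] [AddCommGroup V] [Module k V]

/-- A linear subspace of the tensor algebra that contains `1` and is stable under left
multiplication by vectors is everything. -/
theorem tensor_left_induction {p : TensorAlgebra k V → Prop} (t : TensorAlgebra k V)
    (one : p 1) (add : ∀ a b, p a → p b → p (a + b))
    (smul : ∀ (r : k) a, p a → p (r • a))
    (ι_mul : ∀ v a, p a → p (TensorAlgebra.ι k v * a)) : p t := by
  have key : ∀ a : TensorAlgebra k V, ∀ s, p s → p (a * s) := by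
    intro a
    induction a using TensorAlgebra.induction with
    | algebraMap r =>
      intro s hs
      rw [← Algebra.smul_def]
      exact smul r s hs
    | ι v => exact ι_mul v
    | mul a b ha hb =>
      intro s hs
      rw [mul_assoc]
      exact ha _ (hb s hs)
    | add a b ha hb =>
      intro s hs
      rw [add_mul]
      exact add _ _ (ha s hs) (hb s hs)
  simpa using key t 1 one

/-- The functional on the tensor algebra that is `φ` in degree one and zero in the other
degrees. -/
def degreeOne (φ : V →ₗ[k] k) : TensorAlgebra k V →ₗ[k] k :=
  TrivSqZeroExt.sndHom k k ∘ₗ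
    (TensorAlgebra.lift k (TrivSqZeroExt.inrHom k k ∘ₗ φ)).toLinearMap

theorem fst_lift_inr (φ : V →ₗ[k] k) (t : TensorAlgebra k V) :
    (TensorAlgebra.lift k (TrivSqZeroExt.inrHom k k ∘ₗ φ) t).fst =
      TensorAlgebra.algebraMapInv t := by
  have : (TrivSqZeroExt.fstHom k k k).comp
      (TensorAlgebra.lift k (TrivSqZeroExt.inrHom k k ∘ₗ φ)) =
        TensorAlgebra.algebraMapInv := by
    ext v
    simp [TensorAlgebra.algebraMapInv]
  exact DFunLike.congr_fun this t

theorem algebraMapInv_ι (v : V) :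
    TensorAlgebra.algebraMapInv (TensorAlgebra.ι k v) = (0 : k) := by
  simp [TensorAlgebra.algebraMapInv]

theorem degreeOne_one (φ : V →ₗ[k] k) : degreeOne φ 1 = 0 := by
  simp [degreeOne]

theorem degreeOne_ι_mul (φ : V →ₗ[k] k) (v : V) (t : TensorAlgebra k V) :
    degreeOne φ (TensorAlgebra.ι k v * t) = TensorAlgebra.algebraMapInv t * φ v := by
  have h := fst_lift_inr φ t
  simp [degreeOne, h, mul_comm]

theorem decompose_zero_eq (t : TensorAlgebra k V) :
    (DirectSum.decompose ((LinearMap.range (TensorAlgebra.ι k : V →ₗ[k] _) ^ ·) :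
      ℕ → Submodule k _) t 0 : TensorAlgebra k V) =
      algebraMap k _ (TensorAlgebra.algebraMapInv t) := by
  induction t using tensor_left_induction with
  | one =>
    have h : (1 : TensorAlgebra k V) ∈
      ((LinearMap.range (TensorAlgebra.ι k : V →ₗ[k] _) ^ ·) : ℕ → Submodule k _) 0 :=
          SetLike.GradedOne.one_mem
    rw [DirectSum.decompose_of_mem_same _ h, map_one, map_one]
  | add a b ha hb => rw [DirectSum.decompose_add]; simp [ha, hb]
  | smul r a ha =>
    rw [DirectSum.decompose_smul, map_smul, smul_eq_mul, map_mul, ← ha, ← Algebra.smul_def]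
    rfl
  | ι_mul v a ha =>
    have h : TensorAlgebra.ι k v ∈
      ((LinearMap.range (TensorAlgebra.ι k : V →ₗ[k] _) ^ ·) : ℕ → Submodule k _) 1 := by simp
    rw [DirectSum.coe_decompose_mul_of_left_mem_of_not_le _ h (by simp)]
    simp [algebraMapInv_ι]

/-- This lets `degreeOne φ` descend to the quotient by an ideal concentrated in degrees at least
two: the functional sees only the component of degree one. -/
theorem degreeOne_eq_zero (φ : V →ₗ[k] k) (t : TensorAlgebra k V)
    (h : (DirectSum.decompose ((LinearMap.range (TensorAlgebra.ι k : V →ₗ[k] _) ^ ·) :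
      ℕ → Submodule k _) t 1 : TensorAlgebra k V) = 0) : degreeOne φ t = 0 := by
  have key : degreeOne φ t = degreeOne φ (DirectSum.decompose
      ((LinearMap.range (TensorAlgebra.ι k : V →ₗ[k] _) ^ ·) : ℕ → Submodule k _) t 1) := by
    clear h
    induction t using tensor_left_induction with
    | one =>
      have h : (1 : TensorAlgebra k V) ∈
        ((LinearMap.range (TensorAlgebra.ι k : V →ₗ[k] _) ^ ·) : ℕ → Submodule k _) 0 :=
          SetLike.GradedOne.one_mem
      rw [DirectSum.decompose_of_mem_ne _ h (by simp), degreeOne_one, map_zero]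
    | add a b ha hb => rw [DirectSum.decompose_add, map_add, ha, hb, ← map_add]; rfl
    | smul r a ha => rw [DirectSum.decompose_smul, map_smul, ha, ← map_smul]; rfl
    | ι_mul v a ha =>
      have h : TensorAlgebra.ι k v ∈
        ((LinearMap.range (TensorAlgebra.ι k : V →ₗ[k] _) ^ ·) : ℕ → Submodule k _) 1 := by simp
      rw [DirectSum.coe_decompose_mul_of_left_mem_of_le _ h le_rfl, Nat.sub_self,
        decompose_zero_eq, degreeOne_ι_mul, degreeOne_ι_mul]
      simp
  rw [key, h, map_zero]

end Tensor

namespace YetterDrinfeld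

variable {k G V : Type*} [Field k] [Group G] [AddCommGroup V] [Module k V]
  (Y : YetterDrinfeld k G V)

/-! ### The action on the tensor algebra -/

theorem tensorAct_ι (g : G) (v : V) :
    Y.tensorAct g (TensorAlgebra.ι k v) = TensorAlgebra.ι k (Y.rep g v) := by
  simp [tensorAct]

theorem tensorAct_mul_apply (g h : G) (t : TensorAlgebra k V) :
    Y.tensorAct (g * h) t = Y.tensorAct g (Y.tensorAct h t) := by
  have : Y.tensorAct (g * h) = (Y.tensorAct g).comp (Y.tensorAct h) := by
    ext v
    simp [tensorAct_ι]
  rw [this]; rfl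

theorem tensorAct_one_apply (t : TensorAlgebra k V) : Y.tensorAct 1 t = t := by
  have : Y.tensorAct 1 = AlgHom.id k _ := by
    ext v
    simp [tensorAct_ι]
  rw [this]; rfl

theorem algebraMapInv_tensorAct (g : G) (t : TensorAlgebra k V) :
    TensorAlgebra.algebraMapInv (Y.tensorAct g t) = (TensorAlgebra.algebraMapInv t : k) := by
  have : (TensorAlgebra.algebraMapInv : TensorAlgebra k V →ₐ[k] k).comp (Y.tensorAct g) =
      TensorAlgebra.algebraMapInv := by
    ext v
    simp [tensorAct_ι, algebraMapInv_ι]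
  exact DFunLike.congr_fun this t

theorem degreeOne_tensorAct (φ : V →ₗ[k] k) (g : G) (t : TensorAlgebra k V) :
    degreeOne φ (Y.tensorAct g t) = degreeOne (φ ∘ₗ Y.rep g) t := by
  induction t using tensor_left_induction with
  | one => simp [degreeOne_one]
  | add a b ha hb => simp [ha, hb]
  | smul r a ha => simp [ha]
  | ι_mul v a ha =>
    rw [map_mul, tensorAct_ι, degreeOne_ι_mul, degreeOne_ι_mul, algebraMapInv_tensorAct]
    rfl

theorem mem_component {g : G} {v : V} :
    v ∈ Y.component g ↔ Y.coact v = Finsupp.single g v := Iff.rfl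

theorem mulPrimitive_tmul_of_mem {g : G} {v : V} (hv : v ∈ Y.component g)
    (a b : TensorAlgebra k V) :
    Y.mulPrimitive v (a ⊗ₜ[k] b) = (TensorAlgebra.ι k v * a) ⊗ₜ[k] b +
      Y.tensorAct g a ⊗ₜ[k] (TensorAlgebra.ι k v * b) := by
  rw [mulPrimitive_tmul, Y.mem_component.1 hv, Finsupp.sum_single_index]
  simp

theorem rep_mem_component {g : G} {v : V} (hv : v ∈ Y.component g) (h : G) :
    Y.rep h v ∈ Y.component (h * g * h⁻¹) := by
  rw [mem_component] at hv ⊢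
  ext1 x
  have := Y.coact_rep h v (h⁻¹ * x * h)
  rw [hv] at this
  have e : h * (h⁻¹ * x * h) * h⁻¹ = x := by group
  rw [e] at this
  rw [this]
  by_cases hx : x = h * g * h⁻¹
  · subst hx
    rw [Finsupp.single_eq_same]
    have e' : h⁻¹ * (h * g * h⁻¹) * h = g := by group
    rw [e', Finsupp.single_eq_same]
  · rw [Finsupp.single_eq_of_ne hx, Finsupp.single_eq_of_ne, map_zero]
    intro e'
    apply hx
    rw [← e']; group

/-- Every vector is a sum of homogeneous vectors. -/
theorem homogeneous_induction {p : V → Prop} (v : V) (zero : p 0)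
    (add : ∀ a b, p a → p b → p (a + b)) (mem : ∀ g, ∀ v ∈ Y.component g, p v) : p v := by
  rw [← Y.counit_coact v, Finsupp.sum]
  refine Finset.sum_induction _ p add zero fun g _ => mem g _ ?_
  exact Y.coassoc v g

/-! ### Skew derivations -/

theorem counit_comul (t : TensorAlgebra k V) :
    TensorProduct.lid k _
      (LinearMap.rTensor _ (TensorAlgebra.algebraMapInv : TensorAlgebra k V →ₐ[k] k).toLinearMap
        (Y.comul t)) = t := by
  induction t using tensor_left_induction with
  | one => simp [comul_one]
  | add a b ha hb => simp [ha, hb]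
  | smul r a ha => simp [ha]
  | ι_mul v a ha =>
    induction v using Y.homogeneous_induction with
    | zero => simp
    | add x y hx hy => rw [map_add, add_mul, map_add, map_add, map_add, hx, hy]
    | mem g v hv =>
      rw [comul_ι_mul]
      nth_rewrite 2 [← ha]
      generalize Y.comul a = z
      induction z using TensorProduct.induction_on with
      | zero => simp
      | add x y hx hy => simp only [map_add, hx, hy, mul_add]
      | tmul x y =>
        rw [Y.mulPrimitive_tmul_of_mem hv]
        simp [algebraMapInv_ι, algebraMapInv_tensorAct]

/-- The skew derivation of the tensor algebra attached to a functional `φ` on `V`: if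
`Δ t = 1 ⊗ t + ∑ vᵢ ⊗ tᵢ + ⋯` with `vᵢ ∈ V`, it maps `t` to `∑ φ(vᵢ) tᵢ`. -/
def skewDer (φ : V →ₗ[k] k) : TensorAlgebra k V →ₗ[k] TensorAlgebra k V :=
  (TensorProduct.lid k _).toLinearMap ∘ₗ LinearMap.rTensor _ (degreeOne φ) ∘ₗ Y.comul

theorem skewDer_one (φ : V →ₗ[k] k) : Y.skewDer φ 1 = 0 := by
  simp [skewDer, comul_one, degreeOne_one]

/-- The twisted Leibniz rule. In Δ(v)Δ(t) the summand v ⊗ 1 contributes φ(v) times the counit of the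
left factor, which sums to φ(v)t by `counit_comul`; the summand 1 ⊗ v moves past the left factor by
the action of g, which turns φ into φ ∘ g. -/
theorem skewDer_ι_mul (φ : V →ₗ[k] k) {g : G} {v : V} (hv : v ∈ Y.component g)
    (t : TensorAlgebra k V) :
    Y.skewDer φ (TensorAlgebra.ι k v * t) =
      φ v • t + TensorAlgebra.ι k v * Y.skewDer (φ ∘ₗ Y.rep g) t := by
  nth_rewrite 2 [← Y.counit_comul t]
  simp only [skewDer, LinearMap.comp_apply, comul_ι_mul]
  generalize Y.comul t = z
  induction z using TensorProduct.induction_on with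
  | zero => simp
  | add x y hx hy =>
    simp only [map_add] at hx hy ⊢
    rw [hx, hy, mul_add, smul_add]
    abel
  | tmul x y =>
    rw [Y.mulPrimitive_tmul_of_mem hv]
    simp [degreeOne_ι_mul, degreeOne_tensorAct, smul_smul, mul_comm]

/-- As J has no component of degree one, φ factors through the quotient on the left tensor factor.
The class of the derivative is therefore a function of Δ(t) modulo J ⊗ TV + TV ⊗ J, which is zero.
-/
theorem skewDer_mem_of_isAdmissible {J : Ideal (TensorAlgebra k V)} (hJ : Y.IsAdmissible J)
    (φ : V →ₗ[k] k) {t : TensorAlgebra k V} (ht : t ∈ J) : Y.skewDer φ t ∈ J := by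
  have h0 : ∀ t ∈ J.restrictScalars k, degreeOne φ t = 0 := fun t ht =>
    degreeOne_eq_zero φ t (hJ.degree_ge_two t ht 1 (by norm_num))
  have h1 : (J.restrictScalars k).mkQ (Y.skewDer φ t) =
      TensorProduct.lid k _ (LinearMap.rTensor _ ((J.restrictScalars k).liftQ (degreeOne φ) h0)
        (TensorProduct.map (J.restrictScalars k).mkQ (J.restrictScalars k).mkQ (Y.comul t))) := by
    simp only [skewDer, LinearMap.comp_apply]
    generalize Y.comul t = z
    induction z using TensorProduct.induction_on with
    | zero => simp
    | add x y hx hy => simp only [map_add] at hx hy ⊢; rw [hx, hy]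
    | tmul x y =>
      simp only [LinearMap.rTensor_tmul, TensorProduct.map_tmul, LinearEquiv.coe_coe,
        TensorProduct.lid_tmul, map_smul, Submodule.mkQ_apply]
      rfl
  rw [hJ.comul_mem t ht, map_zero, map_zero, Submodule.mkQ_apply,
    Submodule.Quotient.mk_eq_zero] at h1
  exact h1

theorem skewDer_mem_nicholsIdeal (φ : V →ₗ[k] k) {t : TensorAlgebra k V}
    (ht : t ∈ Y.nicholsIdeal) : Y.skewDer φ t ∈ Y.nicholsIdeal :=
  Y.skewDer_mem_of_isAdmissible Y.nicholsIdeal_isAdmissible φ ht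

end YetterDrinfeld

namespace YetterDrinfeld

variable {k G V : Type*} [Field k] [Group G] [AddCommGroup V] [Module k V]
  (Y : YetterDrinfeld k G V)

/-! ### Primitive quadratic relations -/

/-- The products of two vectors whose degrees multiply to `g`. -/
def quadraticComponent (g : G) : Submodule k (TensorAlgebra k V) :=
  Submodule.span k {t | ∃ g₁ g₂ : G, g₁ * g₂ = g ∧ ∃ u ∈ Y.component g₁, ∃ w ∈ Y.component g₂,
    t = TensorAlgebra.ι k u * TensorAlgebra.ι k w}

/-- A homogeneous quadratic element `r` of degree `g` such that multiplication by `Δ r` is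
multiplication by `r ⊗ 1 + 1 ⊗ r`. -/
def IsQuadraticPrimitive (g : G) (r : TensorAlgebra k V) : Prop :=
  r ∈ Y.quadraticComponent g ∧ ∀ c d : TensorAlgebra k V,
    TensorAlgebra.lift k Y.mulPrimitive r (c ⊗ₜ[k] d) =
      (r * c) ⊗ₜ[k] d + Y.tensorAct g c ⊗ₜ[k] (r * d)

/-- The diagonal action on `TV ⊗ TV`. -/
def tensorAct₂ (h : G) :
    TensorAlgebra k V ⊗[k] TensorAlgebra k V →ₗ[k] TensorAlgebra k V ⊗[k] TensorAlgebra k V :=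
  TensorProduct.map (Y.tensorAct h).toLinearMap (Y.tensorAct h).toLinearMap

theorem tensorAct₂_tmul (h : G) (a b : TensorAlgebra k V) :
    Y.tensorAct₂ h (a ⊗ₜ[k] b) = Y.tensorAct h a ⊗ₜ[k] Y.tensorAct h b := rfl

/-- G acts diagonally by automorphisms of the braided tensor product. This is what carries
primitivity from r to its translates, and so makes the generated ideal G-stable. -/
theorem mulPrimitive_rep (h : G) (v : V) (z : TensorAlgebra k V ⊗[k] TensorAlgebra k V) :
    Y.mulPrimitive (Y.rep h v) (Y.tensorAct₂ h z) = Y.tensorAct₂ h (Y.mulPrimitive v z) := by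
  induction v using Y.homogeneous_induction with
  | zero => simp
  | add x y hx hy => simp only [map_add, LinearMap.add_apply, hx, hy]
  | mem g v hv =>
    induction z using TensorProduct.induction_on with
    | zero => simp
    | add x y hx hy => simp only [map_add, hx, hy]
    | tmul a b =>
      rw [tensorAct₂_tmul, Y.mulPrimitive_tmul_of_mem hv,
        Y.mulPrimitive_tmul_of_mem (Y.rep_mem_component hv h), map_add, tensorAct₂_tmul,
        tensorAct₂_tmul, map_mul, map_mul, tensorAct_ι, ← tensorAct_mul_apply,
        ← tensorAct_mul_apply, inv_mul_cancel_right]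

theorem lift_mulPrimitive_tensorAct (h : G) (t : TensorAlgebra k V)
    (z : TensorAlgebra k V ⊗[k] TensorAlgebra k V) :
    TensorAlgebra.lift k Y.mulPrimitive (Y.tensorAct h t) (Y.tensorAct₂ h z) =
      Y.tensorAct₂ h (TensorAlgebra.lift k Y.mulPrimitive t z) := by
  induction t using tensor_left_induction with
  | one => simp
  | add a b ha hb => simp only [map_add, LinearMap.add_apply, ha, hb]
  | smul r a ha => simp only [map_smul, LinearMap.smul_apply, ha]
  | ι_mul v a ha =>
    simp only [map_mul, tensorAct_ι, TensorAlgebra.lift_ι_apply, Module.End.mul_apply, ha,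
      mulPrimitive_rep]

theorem IsQuadraticPrimitive.tensorAct {g : G} {r : TensorAlgebra k V}
    (hr : Y.IsQuadraticPrimitive g r) (h : G) :
    Y.IsQuadraticPrimitive (h * g * h⁻¹) (Y.tensorAct h r) := by
  constructor
  · have := hr.1
    refine Submodule.span_induction (p := fun r _ => Y.tensorAct h r ∈ _) ?_ (by simp)
      (fun x y _ _ hx hy => ?_) (fun a x _ hx => ?_) this
    · rintro _ ⟨g₁, g₂, rfl, u, hu, w, hw, rfl⟩
      refine Submodule.subset_span ⟨h * g₁ * h⁻¹, h * g₂ * h⁻¹, by group, Y.rep h u,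
        Y.rep_mem_component hu h, Y.rep h w, Y.rep_mem_component hw h, ?_⟩
      rw [map_mul, tensorAct_ι, tensorAct_ι]
    · rw [map_add]; exact add_mem hx hy
    · rw [map_smul]; exact Submodule.smul_mem _ _ hx
  · intro c d
    have e : ∀ x, Y.tensorAct h (Y.tensorAct h⁻¹ x) = x := fun x => by
      rw [← tensorAct_mul_apply, mul_inv_cancel, tensorAct_one_apply]
    have := Y.lift_mulPrimitive_tensorAct h r (Y.tensorAct h⁻¹ c ⊗ₜ[k] Y.tensorAct h⁻¹ d)
    rw [tensorAct₂_tmul, e, e] at this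
    rw [this, hr.2, map_add, tensorAct₂_tmul, tensorAct₂_tmul, map_mul, map_mul, e, e,
      tensorAct_mul_apply, tensorAct_mul_apply]

theorem quadraticComponent_le (g : G) : Y.quadraticComponent g ≤
    LinearMap.range (TensorAlgebra.ι k : V →ₗ[k] _) ^ 2 := by
  refine Submodule.span_le.2 ?_
  rintro _ ⟨g₁, g₂, rfl, u, hu, w, hw, rfl⟩
  rw [pow_two]
  exact Submodule.mul_mem_mul ⟨u, rfl⟩ ⟨w, rfl⟩

theorem tensorCoact_of_mem_quadraticComponent {g : G} {r : TensorAlgebra k V}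
    (hr : r ∈ Y.quadraticComponent g) : Y.tensorCoact r = MonoidAlgebra.single g r := by
  refine Submodule.span_induction (p := fun r _ => Y.tensorCoact r = MonoidAlgebra.single g r)
    ?_ (by simp) (fun x y _ _ hx hy => ?_) (fun a x _ hx => ?_) hr
  · have key : ∀ g', ∀ v ∈ Y.component g', Y.tensorCoact (TensorAlgebra.ι k v) =
        MonoidAlgebra.single g' (TensorAlgebra.ι k v) := by
      intro g' v hv
      simp only [tensorCoact, TensorAlgebra.lift_ι_apply, LinearMap.comp_apply,
        Y.mem_component.1 hv]
      simp
    rintro _ ⟨g₁, g₂, rfl, u, hu, w, hw, rfl⟩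
    rw [map_mul, key _ u hu, key _ w hw, MonoidAlgebra.single_mul_single]
  · rw [map_add, hx, hy, MonoidAlgebra.single_add]
  · rw [map_smul, hx, MonoidAlgebra.smul_single]

/-- The two-sided ideal generated by the primitive quadratic elements. -/
def quadraticIdeal : Ideal (TensorAlgebra k V) :=
  Ideal.span {x | ∃ g r b, Y.IsQuadraticPrimitive g r ∧ x = r * b}

theorem mul_mem_quadraticIdeal {g : G} {r : TensorAlgebra k V}
    (hr : Y.IsQuadraticPrimitive g r) (a b : TensorAlgebra k V) :
    a * (r * b) ∈ Y.quadraticIdeal :=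
  Ideal.mul_mem_left _ _ (Ideal.subset_span ⟨g, r, b, hr, rfl⟩)

theorem quadraticIdeal_induction {p : ∀ t, t ∈ Y.quadraticIdeal → Prop} {t : TensorAlgebra k V}
    (ht : t ∈ Y.quadraticIdeal) (zero : p 0 (zero_mem _))
    (add : ∀ a b ha hb, p a ha → p b hb → p (a + b) (add_mem ha hb))
    (mul : ∀ g r (hr : Y.IsQuadraticPrimitive g r) (a b : TensorAlgebra k V),
      p (a * (r * b)) (Y.mul_mem_quadraticIdeal hr a b)) : p t ht := by
  refine Submodule.closure_induction (p := p) zero (fun x y hx hy => add x y hx hy) ?_ ht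
  rintro a _ ⟨g, r, b, hr, rfl⟩
  exact mul g r hr a b

theorem quadraticIdeal_isTwoSided : Y.quadraticIdeal.IsTwoSided where
  mul_mem_of_left {t} c ht := by
    induction t, ht using Y.quadraticIdeal_induction with
    | zero => simp
    | add a b _ _ ha hb => rw [add_mul]; exact add_mem ha hb
    | mul g r hr a b =>
      rw [mul_assoc, mul_assoc]
      exact Y.mul_mem_quadraticIdeal hr _ _

theorem decompose_quadratic (n : ℕ) {g : G} {r : TensorAlgebra k V}
    (hr : Y.IsQuadraticPrimitive g r) (a b : TensorAlgebra k V) :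
    (DirectSum.decompose ((LinearMap.range (TensorAlgebra.ι k : V →ₗ[k] _) ^ ·) :
      ℕ → Submodule k _) (a * (r * b)) n : TensorAlgebra k V) ∈ Y.quadraticIdeal ∧
    (n < 2 → (DirectSum.decompose ((LinearMap.range (TensorAlgebra.ι k : V →ₗ[k] _) ^ ·) :
      ℕ → Submodule k _) (a * (r * b)) n : TensorAlgebra k V) = 0) := by
  induction a using DirectSum.Decomposition.inductionOn
    ((LinearMap.range (TensorAlgebra.ι k : V →ₗ[k] _) ^ ·) : ℕ → Submodule k _) with
  | zero => simp
  | add a a' ha ha' =>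
    rw [add_mul, DirectSum.decompose_add]
    refine ⟨add_mem ha.1 ha'.1, fun hn => ?_⟩
    rw [DirectSum.add_apply, Submodule.coe_add, ha.2 hn, ha'.2 hn, add_zero]
  | @homogeneous i a =>
    induction b using DirectSum.Decomposition.inductionOn
      ((LinearMap.range (TensorAlgebra.ι k : V →ₗ[k] _) ^ ·) : ℕ → Submodule k _) with
    | zero => simp
    | add a a' ha ha' =>
      rw [mul_add, mul_add, DirectSum.decompose_add]
      refine ⟨add_mem ha.1 ha'.1, fun hn => ?_⟩
      rw [DirectSum.add_apply, Submodule.coe_add, ha.2 hn, ha'.2 hn, add_zero]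
    | @homogeneous j b =>
      have h : (a : TensorAlgebra k V) * (r * b) ∈
          ((LinearMap.range (TensorAlgebra.ι k : V →ₗ[k] _) ^ ·) : ℕ → Submodule k _)
            (i + (2 + j)) :=
        SetLike.GradedMul.mul_mem a.2
          (SetLike.GradedMul.mul_mem (Y.quadraticComponent_le g hr.1) b.2)
      by_cases e : i + (2 + j) = n
      · subst e
        rw [DirectSum.decompose_of_mem_same _ h]
        exact ⟨Y.mul_mem_quadraticIdeal hr _ _, fun hn => by omega⟩
      · rw [DirectSum.decompose_of_mem_ne _ h e]
        simp

/-- The kernel of the projection π to the tensor square of the quotient is stable under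
multiplication by each Δ(v), since the ideal is stable under left multiplication and under G. Hence
only Δ(r)Δ(b) with r primitive has to be examined, and this lies in the kernel by the form of Δ(r).
-/
theorem comul_mem_quadraticIdeal {t : TensorAlgebra k V} (ht : t ∈ Y.quadraticIdeal) :
    TensorProduct.map (Y.quadraticIdeal.restrictScalars k).mkQ
      (Y.quadraticIdeal.restrictScalars k).mkQ (Y.comul t) = 0 := by
  have hact : ∀ h : G, ∀ t ∈ Y.quadraticIdeal, Y.tensorAct h t ∈ Y.quadraticIdeal := by
    intro h t ht
    induction t, ht using Y.quadraticIdeal_induction with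
    | zero => simp
    | add a b _ _ ha hb => rw [map_add]; exact add_mem ha hb
    | mul g r hr a b =>
      rw [map_mul, map_mul]
      exact Y.mul_mem_quadraticIdeal (hr.tensorAct Y h) _ _
  set π := TensorProduct.map (Y.quadraticIdeal.restrictScalars k).mkQ
      (Y.quadraticIdeal.restrictScalars k).mkQ with hπ
  have hπ0 : ∀ a b, a ∈ Y.quadraticIdeal ∨ b ∈ Y.quadraticIdeal → π (a ⊗ₜ[k] b) = 0 := by
    rintro a b (h | h)
    · have : (Y.quadraticIdeal.restrictScalars k).mkQ a = 0 :=
        (Submodule.Quotient.mk_eq_zero _).2 h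
      rw [hπ, TensorProduct.map_tmul, this, TensorProduct.zero_tmul]
    · have : (Y.quadraticIdeal.restrictScalars k).mkQ b = 0 :=
        (Submodule.Quotient.mk_eq_zero _).2 h
      rw [hπ, TensorProduct.map_tmul, this, TensorProduct.tmul_zero]
  have hmk : ∀ v : V, Y.quadraticIdeal.restrictScalars k ≤
      (Y.quadraticIdeal.restrictScalars k).comap
        (LinearMap.mulLeft k (TensorAlgebra.ι k v)) :=
    fun v t ht => Ideal.mul_mem_left _ _ ht
  have hmulPrim : ∀ v z, π z = 0 → π (Y.mulPrimitive v z) = 0 := by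
    intro v z hz
    induction v using Y.homogeneous_induction with
    | zero => simp
    | add x y hx hy => rw [map_add, LinearMap.add_apply, map_add, hx, hy, add_zero]
    | mem g v hv =>
      have : π (Y.mulPrimitive v z) =
          TensorProduct.map (Submodule.mapQ _ _ _ (hmk v)) LinearMap.id (π z) +
            TensorProduct.map (Submodule.mapQ (Y.quadraticIdeal.restrictScalars k)
              (Y.quadraticIdeal.restrictScalars k) (Y.tensorAct g).toLinearMap (hact g))
              (Submodule.mapQ _ _ _ (hmk v)) (π z) := by
        clear hz
        induction z using TensorProduct.induction_on with
        | zero => simp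
        | add x y hx hy => simp only [map_add] at hx hy ⊢; rw [hx, hy]; abel
        | tmul x y =>
          rw [Y.mulPrimitive_tmul_of_mem hv]
          simp [hπ]
          rfl
      rw [this, hz, map_zero, map_zero, add_zero]
  have hlift : ∀ a z, π z = 0 → π (TensorAlgebra.lift k Y.mulPrimitive a z) = 0 := by
    intro a z hz
    induction a using tensor_left_induction with
    | one => simpa
    | add x y hx hy => rw [map_add, LinearMap.add_apply, map_add, hx, hy, add_zero]
    | smul r a ha => rw [map_smul, LinearMap.smul_apply, map_smul, ha, smul_zero]
    | ι_mul v a ha =>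
      rw [map_mul, Module.End.mul_apply, TensorAlgebra.lift_ι_apply]
      exact hmulPrim _ _ ha
  induction t, ht using Y.quadraticIdeal_induction with
  | zero => simp
  | add a b _ _ ha hb => rw [map_add, map_add, ha, hb, add_zero]
  | mul g r hr a b =>
    simp only [comul, LinearMap.comp_apply, AlgHom.toLinearMap_apply, map_mul,
      LinearMap.applyₗ_apply_apply, Module.End.mul_apply]
    -- Stability of the kernel removes the left factor a; only the action of r on an arbitrary
    -- tensor remains.
    refine hlift a _ ?_
    generalize TensorAlgebra.lift k Y.mulPrimitive b (1 ⊗ₜ[k] 1) = z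
    induction z using TensorProduct.induction_on with
    | zero => simp
    | add x y hx hy => rw [map_add, map_add, hx, hy, add_zero]
    | tmul x y =>
      rw [hr.2, map_add, hπ0 _ _ (Or.inl ?_), hπ0 _ _ (Or.inr ?_), add_zero]
      · simpa using Y.mul_mem_quadraticIdeal hr 1 y
      · simpa using Y.mul_mem_quadraticIdeal hr 1 x

theorem quadraticIdeal_isAdmissible : Y.IsAdmissible Y.quadraticIdeal where
  isTwoSided := Y.quadraticIdeal_isTwoSided
  graded t ht n := by
    induction t, ht using Y.quadraticIdeal_induction with
    | zero => simp
    | add a b _ _ ha hb => rw [DirectSum.decompose_add]; exact add_mem ha hb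
    | mul g r hr a b => exact (Y.decompose_quadratic n hr a b).1
  degree_ge_two t ht n hn := by
    induction t, ht using Y.quadraticIdeal_induction with
    | zero => simp
    | add a b _ _ ha hb => rw [DirectSum.decompose_add, DirectSum.add_apply, Submodule.coe_add, ha,
        hb, add_zero]
    | mul g r hr a b => exact (Y.decompose_quadratic n hr a b).2 hn
  act_mem t ht h := by
    induction t, ht using Y.quadraticIdeal_induction with
    | zero => simp
    | add a b _ _ ha hb => rw [map_add]; exact add_mem ha hb
    | mul g r hr a b =>
      rw [map_mul, map_mul]
      exact Y.mul_mem_quadraticIdeal (hr.tensorAct Y h) _ _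
  coact_mem t ht h := by
    induction t, ht using Y.quadraticIdeal_induction with
    | zero => simp
    | add a b _ _ ha hb => rw [map_add]; exact add_mem ha hb
    | mul g r hr a b =>
      rw [map_mul, map_mul, Y.tensorCoact_of_mem_quadraticComponent hr.1]
      generalize Y.tensorCoact a = x
      generalize Y.tensorCoact b = y
      induction x using MonoidAlgebra.induction_linear with
      | zero => simp
      | add x x' hx hx' => rw [add_mul]; exact add_mem hx hx'
      | single g₁ a =>
        induction y using MonoidAlgebra.induction_linear with
        | zero => simp
        | add x x' hx hx' => rw [mul_add, mul_add]; exact add_mem hx hx'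
        | single g₂ b =>
          rw [MonoidAlgebra.single_mul_single, MonoidAlgebra.single_mul_single]
          by_cases e : g₁ * (g * g₂) = h
          · subst e
            simpa using Y.mul_mem_quadraticIdeal hr a b
          · simp [Finsupp.single_eq_of_ne (Ne.symm e)]
  counit_eq_zero t ht := by
    induction t, ht using Y.quadraticIdeal_induction with
    | zero => simp
    | add a b _ _ ha hb => rw [map_add, ha, hb, add_zero]
    | mul g r hr a b =>
      have := (Y.decompose_quadratic 0 hr a b).2 (by norm_num)
      rw [decompose_zero_eq] at this
      simpa using this
  comul_mem t ht := Y.comul_mem_quadraticIdeal ht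

theorem IsQuadraticPrimitive.mem_nicholsIdeal {g : G} {r : TensorAlgebra k V}
    (hr : Y.IsQuadraticPrimitive g r) : r ∈ Y.nicholsIdeal := by
  have h : Y.quadraticIdeal ≤ Y.nicholsIdeal := le_sSup Y.quadraticIdeal_isAdmissible
  exact h (by simpa using Y.mul_mem_quadraticIdeal hr 1 1)

end YetterDrinfeld

/-! ### Words in the six transpositions -/

/-- Labels for the six transpositions. -/
inductive Letter
  | l₁ | l₂ | l₃ | l₄ | l₅ | l₆
  deriving DecidableEq

namespace Letter

instance : Fintype Letter where
  elems := {l₁, l₂, l₃, l₄, l₅, l₆}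
  complete i := by cases i <;> decide

/-- The function with the given six values. -/
def table {α : Type*} (y₁ y₂ y₃ y₄ y₅ y₆ : α) : Letter → α
  | l₁ => y₁ | l₂ => y₂ | l₃ => y₃ | l₄ => y₄ | l₅ => y₅ | l₆ => y₆

/-- The rack operation on labels. -/
def act : Letter → Letter → Letter
  | l₁ => table l₁ l₃ l₂ l₄ l₆ l₅
  | l₂ => table l₃ l₂ l₁ l₅ l₄ l₆
  | l₃ => table l₂ l₁ l₃ l₆ l₅ l₄
  | l₄ => table l₁ l₅ l₆ l₄ l₂ l₃
  | l₅ => table l₆ l₄ l₃ l₂ l₅ l₁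
  | l₆ => table l₅ l₂ l₄ l₃ l₁ l₆

/-- Boolean equality of labels. -/
def beq : Letter → Letter → Bool
  | l₁ => table true false false false false false
  | l₂ => table false true false false false false
  | l₃ => table false false true false false false
  | l₄ => table false false false true false false
  | l₅ => table false false false false true false
  | l₆ => table false false false false false true

theorem act_act (i j : Letter) : act i (act i j) = j := by
  cases i <;> cases j <;> rfl

theorem act_self (i : Letter) : act i i = i := by
  cases i <;> rfl

theorem beq_iff (i j : Letter) : beq i j = true ↔ i = j := by
  cases i <;> cases j <;> simp [beq, table]

/-- The words obtained from `w` by deleting a letter that reads `j` once it has been moved to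
the front. -/
def picks : List Letter → Letter → List (List Letter)
  | [], _ => []
  | i :: w, j => cond (beq i j) (w :: (picks w (act i j)).map (i :: ·))
      ((picks w (act i j)).map (i :: ·))

/-- Whether `w` can be exhausted by picking successively the letters of `f`. -/
def reach : List Letter → List Letter → Bool
  | [], w => w.isEmpty
  | j :: f, w => (picks w j).any (reach f)

/-- Whether a word can be exhausted by picking its own letters only in the obvious way. -/
def rigid : List Letter → Bool
  | [] => true
  | i :: w => cond ((picks w i).any fun u => reach w (i :: u)) false (rigid w)

/-- The leading words of a Gröbner basis of the quadratic algebra. -/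
def leadingWords : List (List Letter) :=
  [[l₁, l₁], [l₃, l₁], [l₃, l₂], [l₄, l₁], [l₆, l₁], [l₆, l₅], [l₂, l₂], [l₄, l₅], [l₄, l₂],
    [l₆, l₂], [l₃, l₃], [l₆, l₃], [l₃, l₅], [l₆, l₄], [l₄, l₄], [l₅, l₅], [l₆, l₆],
    [l₂, l₁, l₂], [l₅, l₁, l₅], [l₅, l₂, l₅], [l₄, l₃, l₄], [l₅, l₁, l₂, l₅], [l₅, l₂, l₁, l₅],
    [l₅, l₁, l₂, l₁, l₅, l₂], [l₅, l₁, l₂, l₁, l₅, l₁]]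

/-- Whether the first word is an initial segment of the second one. -/
def isPrefix : List Letter → List Letter → Bool
  | [], _ => true
  | _ :: _, [] => false
  | i :: f, j :: w => cond (beq i j) (isPrefix f w) false

/-- Whether a word contains no leading word. -/
def normal : List Letter → Bool
  | [] => true
  | i :: w => cond (leadingWords.any fun f => isPrefix f (i :: w)) false (normal w)

/-- The list of normal words of length `n`. -/
def normalWords : ℕ → List (List Letter)
  | 0 => [[]]
  | n + 1 => [l₁, l₂, l₃, l₄, l₅, l₆].flatMap fun i =>
      ((normalWords n).map (i :: ·)).filter normal

/-- A statistic on words with respect to which the pairing between normal words is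
triangular. -/
def height (w : List Letter) : ℕ :=
  -- The weights enter only through `triangular_normalWords` and `triangular_quadraticWords`. The
  -- letter sum is a multiple of 10, so the third letter, of weight at most 5, only breaks ties;
  -- words shorter than three letters get 0 for it.
  w.foldr (fun i n => table 100 100 10 10 100 0 i + n) 0 +
    (w.drop 2).head?.elim 0 (table 0 1 2 3 4 5)

/-- The pairing between the listed words is triangular with respect to `h`. -/
def triangular (h : List Letter → ℕ) (L : List (List Letter)) : Bool :=
  L.all fun f => L.all fun w =>
    cond (Nat.blt (h w) (h f)) true (cond (reach f w) (isPrefix f w) true)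

theorem normalWords_length : (List.range 14).map (fun n => (normalWords n).length) =
    [1, 6, 19, 42, 71, 96, 106, 96, 71, 42, 19, 6, 1, 0] := by decide +kernel

theorem rigid_normalWords : ((List.range 13).all fun n => (normalWords n).all rigid) = true := by
  decide +kernel

theorem triangular_normalWords :
    ((List.range 13).all fun n => triangular height (normalWords n)) = true := by
  decide +kernel

end Letter

namespace Letter

theorem isPrefix_iff (f w : List Letter) : isPrefix f w = true ↔ ∃ c, w = f ++ c := by
  induction f generalizing w with
  | nil => simp [isPrefix]
  | cons i f ih =>
    cases w with
    | nil => simp [isPrefix]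
    | cons j w =>
      by_cases h : i = j
      · subst h
        simp [isPrefix, (beq_iff i i).2 rfl, ih]
      · have : beq i j = false := by
          rw [← Bool.not_eq_true, beq_iff]; exact h
        simp [isPrefix, this, Ne.symm h]

theorem length_of_mem_picks {u w : List Letter} {j : Letter} (h : u ∈ picks w j) :
    u.length + 1 = w.length := by
  induction w generalizing u j with
  | nil => simp [picks] at h
  | cons i w ih =>
    have key : ∀ u ∈ (picks w (act i j)).map (i :: ·), u.length + 1 = (i :: w).length := by
      intro u hu
      obtain ⟨u', hu', rfl⟩ := List.mem_map.1 hu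
      simp [ih hu']
    rw [picks] at h
    cases hb : beq i j with
    | false => rw [hb] at h; exact key u h
    | true =>
      rw [hb] at h
      rcases List.mem_cons.1 h with rfl | h
      · rfl
      · exact key u h

theorem length_of_reach {f w : List Letter} (h : reach f w = true) : f.length = w.length := by
  induction f generalizing w with
  | nil =>
    rw [reach, List.isEmpty_iff] at h
    rw [h]
  | cons j f ih =>
    rw [reach, List.any_eq_true] at h
    obtain ⟨u, hu, h⟩ := h
    rw [List.length_cons, ih h, length_of_mem_picks hu]

theorem mem_normalWords {n : ℕ} {w : List Letter} :
    w ∈ normalWords n ↔ normal w = true ∧ w.length = n := by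
  induction n generalizing w with
  | zero =>
    rw [normalWords, List.mem_singleton, List.length_eq_zero_iff]
    constructor
    · rintro rfl; exact ⟨rfl, rfl⟩
    · exact fun h => h.2
  | succ n ih =>
    rw [normalWords, List.mem_flatMap]
    constructor
    · rintro ⟨i, -, h⟩
      rw [List.mem_filter, List.mem_map] at h
      obtain ⟨⟨w, hw, rfl⟩, h⟩ := h
      exact ⟨h, by rw [List.length_cons, (ih.1 hw).2]⟩
    · rintro ⟨h, hl⟩
      cases w with
      | nil => simp at hl
      | cons i w =>
        refine ⟨i, by cases i <;> simp, List.mem_filter.2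
          ⟨List.mem_map.2 ⟨w, ih.2 ⟨?_, ?_⟩, rfl⟩, h⟩⟩
        · rw [normal] at h
          cases hb : leadingWords.any fun f => isPrefix f (i :: w) with
          | false => rw [hb] at h; exact h
          | true => rw [hb] at h; simp at h
        · simpa using hl

theorem nodup_normalWords (n : ℕ) : (normalWords n).Nodup := by
  induction n with
  | zero => simp [normalWords]
  | succ n ih =>
    rw [normalWords, List.nodup_flatMap]
    refine ⟨fun i _ => (ih.map (List.cons_injective)).filter _, ?_⟩
    have key : ∀ i j : Letter, i ≠ j → Function.onFun List.Disjoint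
        (fun i => ((normalWords n).map (i :: ·)).filter normal) i j := by
      intro i j hij w h1 h2
      rw [List.mem_filter, List.mem_map] at h1 h2
      obtain ⟨⟨w1, -, rfl⟩, -⟩ := h1
      obtain ⟨⟨w2, -, e⟩, -⟩ := h2
      exact hij (List.cons.inj e).1.symm
    refine List.Pairwise.imp (fun {i j} h => key i j h) (?_ : List.Pairwise (· ≠ ·) _)
    decide

/-- The number of normal words of length `n`. -/
def count (n : ℕ) : ℕ := (normalWords n).length

theorem count_eq : [count 0, count 1, count 2, count 3, count 4, count 5, count 6, count 7,
    count 8, count 9, count 10, count 11, count 12, count 13] =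
      [1, 6, 19, 42, 71, 96, 106, 96, 71, 42, 19, 6, 1, 0] := normalWords_length

/-- A normal word of length n + 1 is a letter followed by a normal word of length n, so the zero
found at length 13 persists. -/
theorem normalWords_eq_nil (n : ℕ) : normalWords (n + 13) = [] := by
  induction n with
  | zero =>
    have := congrArg (fun l => l[13]?) count_eq
    simpa [count] using this
  | succ n ih =>
    rw [show n + 1 + 13 = (n + 13) + 1 from by omega, normalWords, ih]
    simp

theorem length_lt_of_normal {w : List Letter} (h : normal w = true) : w.length < 13 := by
  by_contra h'
  obtain ⟨n, hn⟩ := Nat.exists_eq_add_of_le (not_lt.1 h')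
  have := mem_normalWords.2 ⟨h, hn⟩
  rw [add_comm, normalWords_eq_nil] at this
  simp at this

theorem rigid_of_normal {w : List Letter} (h : normal w = true) : rigid w = true := by
  have := rigid_normalWords
  simp only [List.all_eq_true, List.mem_range] at this
  exact this w.length (length_lt_of_normal h) w (mem_normalWords.2 ⟨h, rfl⟩)

/-- Reachability forces equal lengths, so the prefix test inside `triangular` amounts to equality of
words. -/
theorem of_triangular {h : List Letter → ℕ} {L : List (List Letter)}
    (hL : triangular h L = true) {f w : List Letter} (hf : f ∈ L) (hw : w ∈ L)
    (hr : reach f w = true) : f = w ∨ h w < h f := by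
  have hl := length_of_reach hr
  rw [triangular] at hL
  simp only [List.all_eq_true] at hL
  have := hL f hf w hw
  rw [hr, Bool.cond_true] at this
  cases hb : Nat.blt (h w) (h f) with
  | true => exact Or.inr (by rwa [Nat.blt_eq] at hb)
  | false =>
    rw [hb, Bool.cond_false, isPrefix_iff] at this
    obtain ⟨c, rfl⟩ := this
    rw [List.length_append] at hl
    have : c = [] := List.length_eq_zero_iff.1 (by omega)
    simp [this]

theorem triangular_of_normal {f w : List Letter} (hf : normal f = true) (hw : normal w = true)
    (hr : reach f w = true) : f = w ∨ height w < height f := by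
  have := triangular_normalWords
  rw [List.all_eq_true] at this
  exact of_triangular (this _ (List.mem_range.2 (length_lt_of_normal hw)))
    (mem_normalWords.2 ⟨hf, length_of_reach hr⟩) (mem_normalWords.2 ⟨hw, rfl⟩) hr

/-! ### Spanning by normal words -/

/-- The value of a word, read as a number in base six. -/
def value : List Letter → ℕ
  | [] => 0
  -- The digits order the letters as l₁ < l₂ < l₅ < l₃ < l₄ < l₆; on words of equal length, `value`
  -- is then the lexicographic order.
  | i :: w => table 0 1 3 4 2 5 i * 6 ^ w.length + value w

theorem value_append (a c : List Letter) :
    value (a ++ c) = value a * 6 ^ c.length + value c := by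
  induction a with
  | nil => simp [value]
  | cons i a ih =>
    rw [List.cons_append, value, ih, value, List.length_append, pow_add]
    ring

theorem value_append_lt (a c : List Letter) {f u : List Letter} (hl : u.length = f.length)
    (h : value u < value f) : value (a ++ (u ++ c)) < value (a ++ (f ++ c)) := by
  simp only [value_append, List.length_append, hl]
  have : value u * 6 ^ c.length < value f * 6 ^ c.length :=
    Nat.mul_lt_mul_of_pos_right h (by positivity)
  omega

theorem exists_leadingWord {w : List Letter} (h : normal w = false) :
    ∃ a c, ∃ f ∈ leadingWords, w = a ++ (f ++ c) := by
  induction w with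
  | nil => simp [normal] at h
  | cons i w ih =>
    rw [normal] at h
    cases hb : leadingWords.any fun f => isPrefix f (i :: w) with
    | true =>
      rw [List.any_eq_true] at hb
      obtain ⟨f, hf, hp⟩ := hb
      obtain ⟨c, hc⟩ := (isPrefix_iff _ _).1 hp
      exact ⟨[], c, f, hf, by simpa using hc⟩
    | false =>
      rw [hb, Bool.cond_false] at h
      obtain ⟨a, c, f, hf, rfl⟩ := ih h
      exact ⟨i :: a, c, f, hf, rfl⟩

/-- The product of the elements `y i` along a word. -/
def eval {A : Type*} [Monoid A] (y : Letter → A) (w : List Letter) : A := (w.map y).prod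

theorem eval_append {A : Type*} [Monoid A] (y : Letter → A) (a c : List Letter) :
    eval y (a ++ c) = eval y a * eval y c := by
  simp [eval]

/-- Rewriting terminates: replacing a leading word inside a monomial by smaller words of the same
length strictly lowers `value` and keeps the length. -/
theorem eval_mem_span_normal {k A : Type*} [Field k] [Ring A] [Algebra k A] (y : Letter → A)
    (hy : ∀ f ∈ leadingWords, eval y f ∈
      Submodule.span k (eval y '' {u | u.length = f.length ∧ value u < value f}))
    (w : List Letter) : eval y w ∈
      Submodule.span k (eval y '' {u | normal u = true ∧ u.length = w.length}) := by
  induction hn : value w using Nat.strong_induction_on generalizing w with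
  | _ n ih =>
    cases hw : normal w with
    | true => exact Submodule.subset_span ⟨w, ⟨hw, rfl⟩, rfl⟩
    | false =>
      obtain ⟨a, c, f, hf, rfl⟩ := exists_leadingWord hw
      rw [eval_append, eval_append]
      have h := hy f hf
      refine Submodule.span_induction (p := fun z _ => eval y a * (z * eval y c) ∈ _)
        ?_ (by simp) (fun p q _ _ hp hq => ?_) (fun r p _ hp => ?_) h
      · rintro _ ⟨u, ⟨hul, hu⟩, rfl⟩
        rw [← eval_append, ← eval_append]
        have h1 := value_append_lt a c hul hu
        have h2 := ih _ (hn ▸ h1) (a ++ (u ++ c)) rfl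
        simpa only [List.length_append, hul] using h2
      · rw [add_mul, mul_add]; exact add_mem hp hq
      · rw [smul_mul_assoc, mul_smul_comm]; exact Submodule.smul_mem _ _ hp

end Letter

/-! ### Linear independence from triangular functionals -/

theorem linearIndependent_of_functionals {k M ι : Type*} [Field k] [AddCommGroup M] [Module k M]
    (v : ι → M) (F : ι → M →ₗ[k] k) (h : ι → ℕ) (h1 : ∀ i, F i (v i) ≠ 0)
    (h2 : ∀ i j, F i (v j) ≠ 0 → i = j ∨ h j < h i) : LinearIndependent k v := by
  rw [linearIndependent_iff]
  intro l hl
  by_contra hne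
  -- At an index of least height in the support, the functional `F i` sees no other term of the
  -- relation, so the coefficient there must vanish.
  obtain ⟨i, hi, hmin⟩ := l.support.exists_min_image h (Finsupp.support_nonempty_iff.2 hne)
  have : F i (Finsupp.linearCombination k v l) = l i * F i (v i) := by
    rw [Finsupp.linearCombination_apply, Finsupp.sum, map_sum, Finset.sum_eq_single i]
    · rw [map_smul, smul_eq_mul]
    · intro j hj hji
      rw [map_smul, smul_eq_mul]
      by_contra hc
      rcases h2 i j (right_ne_zero_of_mul hc) with e | e
      · exact hji e.symm
      · exact absurd (hmin j hj) (not_le.2 e)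
    · intro h
      exact absurd hi h
  rw [hl, map_zero] at this
  exact mul_ne_zero (Finsupp.mem_support_iff.1 hi) (h1 i) this.symm

/-! ### Iterated skew derivations as functionals on the Nichols algebra -/

namespace YetterDrinfeld

open Letter

variable {k G V : Type*} [Field k] [Group G] [AddCommGroup V] [Module k V]
  (Y : YetterDrinfeld k G V)

theorem skewDer_smul (c : k) (φ : V →ₗ[k] k) (t : TensorAlgebra k V) :
    Y.skewDer (c • φ) t = c • Y.skewDer φ t := by
  have : degreeOne (c • φ) = c • degreeOne φ := by
    ext t
    induction t using tensor_left_induction with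
    | one => simp [degreeOne_one]
    | add a b ha hb => simp only [map_add, ha, hb]
    | smul r a ha => simp only [map_smul, ha]
    | ι_mul v a ha =>
      rw [LinearMap.smul_apply, degreeOne_ι_mul, degreeOne_ι_mul, LinearMap.smul_apply,
        smul_eq_mul, smul_eq_mul]
      ring
  simp [skewDer, this, LinearMap.rTensor_smul]

/-- `b` is a basis of the Yetter-Drinfeld module `Y` that consists of vectors `b i` of degree
`x i`, on which the `x i` act by the rack operation and the coefficients `q`. -/
structure IsLetterBasis (x : Letter → G) (q : Letter → Letter → k)
    (b : Module.Basis Letter k V) : Prop where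
  mem : ∀ i, b i ∈ Y.component (x i)
  rep : ∀ i j, Y.rep (x i) (b j) = q i j • b (act i j)

/-- The monomial in the tensor algebra attached to a word. -/
def mon (b : Module.Basis Letter k V) (w : List Letter) : TensorAlgebra k V :=
  eval (fun i => TensorAlgebra.ι k (b i)) w

/-- The functional on the tensor algebra attached to a word: the iterated skew derivations. -/
def pairing (b : Module.Basis Letter k V) : List Letter → TensorAlgebra k V →ₗ[k] k
  | [] => TensorAlgebra.algebraMapInv.toLinearMap
  | i :: f => pairing b f ∘ₗ Y.skewDer (b.coord i)

theorem pairing_eq_zero_of_mem (b : Module.Basis Letter k V) (f : List Letter)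
    {t : TensorAlgebra k V} (ht : t ∈ Y.nicholsIdeal) : Y.pairing b f t = 0 := by
  induction f generalizing t with
  | nil => exact Y.counit_nicholsIdeal t ht
  | cons i f ih => exact ih (Y.skewDer_mem_nicholsIdeal _ ht)

variable {Y}

namespace IsLetterBasis

variable {x : Letter → G} {q : Letter → Letter → k} {b : Module.Basis Letter k V}
  (hb : Y.IsLetterBasis x q b)

include hb

theorem coord_comp_rep (i j : Letter) :
    b.coord j ∘ₗ Y.rep (x i) = q i (act i j) • b.coord (act i j) := by
  refine b.ext fun l => ?_
  simp only [LinearMap.comp_apply, hb.rep, map_smul, LinearMap.smul_apply, Module.Basis.coord_apply,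
    Module.Basis.repr_self, smul_eq_mul]
  by_cases h : l = act i j
  · subst h
    rw [act_act, Finsupp.single_eq_same, Finsupp.single_eq_same]
  · rw [Finsupp.single_eq_of_ne (Ne.symm h), Finsupp.single_eq_of_ne, mul_zero, mul_zero]
    rintro rfl
    exact h (act_act i l).symm

theorem skewDer_ι_mul (i j : Letter) (t : TensorAlgebra k V) :
    Y.skewDer (b.coord j) (TensorAlgebra.ι k (b i) * t) =
      (if i = j then t else 0) +
        q i (act i j) • (TensorAlgebra.ι k (b i) * Y.skewDer (b.coord (act i j)) t) := by
  rw [Y.skewDer_ι_mul _ (hb.mem i), hb.coord_comp_rep, skewDer_smul, mul_smul_comm]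
  congr 1
  by_cases h : i = j
  · simp [h]
  · simp [h, Finsupp.single_eq_of_ne (Ne.symm h)]

/-- By the twisted Leibniz rule the derivation either removes the first letter i, if i = j, or
passes it and continues with the label `act i j`. `picks` lists the outcomes without their
coefficients. -/
theorem skewDer_mon (j : Letter) (w : List Letter) :
    Y.skewDer (b.coord j) (mon b w) ∈ Submodule.span k (mon b '' {u | u ∈ picks w j}) := by
  induction w generalizing j with
  | nil => simp [mon, eval, skewDer_one]
  | cons i w ih =>
    have h : mon b (i :: w) = TensorAlgebra.ι k (b i) * mon b w := by simp [mon, eval]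
    have key : TensorAlgebra.ι k (b i) * Y.skewDer (b.coord (act i j)) (mon b w) ∈
        Submodule.span k (mon b '' {u | u ∈ (picks w (act i j)).map (i :: ·)}) := by
      refine Submodule.span_induction (p := fun z _ => TensorAlgebra.ι k (b i) * z ∈ _)
        ?_ (by simp) (fun p q _ _ hp hq => ?_) (fun r p _ hp => ?_) (ih (act i j))
      · rintro _ ⟨u, hu, rfl⟩
        refine Submodule.subset_span ⟨i :: u, List.mem_map.2 ⟨u, hu, rfl⟩, ?_⟩
        simp [mon, eval]
      · rw [mul_add]; exact add_mem hp hq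
      · rw [mul_smul_comm]; exact Submodule.smul_mem _ _ hp
    rw [h, hb.skewDer_ι_mul]
    cases hc : beq i j with
    | false =>
      have hij : ¬ i = j := by rw [← beq_iff, hc]; simp
      rw [if_neg hij, zero_add, picks, hc]
      exact Submodule.smul_mem _ _ key
    | true =>
      rw [if_pos ((beq_iff i j).1 hc), picks, hc]
      refine add_mem (Submodule.subset_span ⟨w, List.mem_cons_self, rfl⟩)
        (Submodule.smul_mem _ _ (Submodule.span_mono (Set.image_mono ?_) key))
      exact fun u hu => List.mem_cons_of_mem _ hu

/-- Only the supports of the successive derivatives are followed, so this certificate of vanishing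
is valid for all coefficients `q` and all fields. -/
theorem pairing_mon_eq_zero {f w : List Letter} (h : reach f w = false) :
    Y.pairing b f (mon b w) = 0 := by
  induction f generalizing w with
  | nil =>
    cases w with
    | nil => simp [reach] at h
    | cons i w =>
      simp [pairing, mon, eval, algebraMapInv_ι]
  | cons j f ih =>
    refine Submodule.span_induction (p := fun z _ => Y.pairing b f z = 0)
      ?_ (by simp) (fun p q _ _ hp hq => ?_) (fun r p _ hp => ?_) (hb.skewDer_mon j w)
    · rintro _ ⟨u, hu, rfl⟩
      rw [reach, List.any_eq_false] at h
      exact ih (by simpa using h u hu)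
    · rw [map_add, hp, hq, add_zero]
    · rw [map_smul, hp, smul_zero]

/-- For a rigid word the only surviving way to exhaust it is to remove the first letter each time.
That branch carries the coefficient 1, so the value does not depend on `q`. -/
theorem pairing_mon_self {w : List Letter} (h : rigid w = true) :
    Y.pairing b w (mon b w) = 1 := by
  induction w with
  | nil => simp [pairing, mon, eval]
  | cons i w ih =>
    rw [rigid] at h
    cases hr : (picks w i).any fun u => reach w (i :: u) with
    | true => rw [hr] at h; simp at h
    | false =>
      rw [hr, Bool.cond_false] at h
      rw [List.any_eq_false] at hr
      have hm : mon b (i :: w) = TensorAlgebra.ι k (b i) * mon b w := by simp [mon, eval]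
      rw [pairing, LinearMap.comp_apply, hm, hb.skewDer_ι_mul, if_pos rfl, map_add, ih h,
        act_self, map_smul]
      have key : Y.pairing b w (TensorAlgebra.ι k (b i) * Y.skewDer (b.coord i) (mon b w)) = 0 := by
        refine Submodule.span_induction
          (p := fun z _ => Y.pairing b w (TensorAlgebra.ι k (b i) * z) = 0)
          ?_ (by simp) (fun p q _ _ hp hq => ?_) (fun r p _ hp => ?_) (hb.skewDer_mon i w)
        · rintro _ ⟨u, hu, rfl⟩
          have := hb.pairing_mon_eq_zero (f := w) (w := i :: u) (by simpa using hr u hu)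
          simpa [mon, eval] using this
        · rw [mul_add, map_add, hp, hq, add_zero]
        · rw [mul_smul_comm, map_smul, hp, smul_zero]
      rw [key, smul_zero, add_zero]

/-- A square can be exhausted in two ways, removing the first or the second letter first; they
contribute 1 and q_ii. -/
theorem pairing_square (i : Letter) : Y.pairing b [i, i] (mon b [i, i]) = 1 + q i i := by
  have hm : ∀ i w, mon b (i :: w) = TensorAlgebra.ι k (b i) * mon b w := by simp [mon, eval]
  have h1 : mon b [] = 1 := by simp [mon, eval]
  have h2 : Y.skewDer (b.coord i) (TensorAlgebra.ι k (b i)) = 1 := by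
    simpa [skewDer_one] using hb.skewDer_ι_mul i i 1
  simp only [pairing, LinearMap.comp_apply, hm, h1, mul_one]
  rw [hb.skewDer_ι_mul]
  simp [h2, act_self]

end IsLetterBasis

variable (Y)

/-- The class in the Nichols algebra of the monomial attached to a word. -/
def nicholsMon (b : Module.Basis Letter k V) (w : List Letter) : Y.Nichols :=
  Y.nicholsMk (mon b w)

theorem nicholsMon_eq_eval (b : Module.Basis Letter k V) (w : List Letter) :
    Y.nicholsMon b w = eval (fun i => Y.toNichols (b i)) w := by
  rw [nicholsMon, mon, eval, eval, map_list_prod, List.map_map]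
  rfl

theorem linearIndependent_nicholsMon (b : Module.Basis Letter k V) {ι : Type*}
    (w : ι → List Letter) (h : ι → ℕ) (h1 : ∀ i, Y.pairing b (w i) (mon b (w i)) ≠ 0)
    (h2 : ∀ i j, Y.pairing b (w i) (mon b (w j)) ≠ 0 → i = j ∨ h j < h i) :
    LinearIndependent k fun i => Y.nicholsMon b (w i) := by
  have hk : ∀ f, ∀ t ∈ LinearMap.ker Y.nicholsMk.toLinearMap, Y.pairing b f t = 0 :=
    fun f t ht => Y.pairing_eq_zero_of_mem b f ((Y.nicholsMk_eq_zero t).1 ht)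
  have hs : Function.Surjective Y.nicholsMk.toLinearMap := Ideal.Quotient.mk_surjective
  let e := Y.nicholsMk.toLinearMap.quotKerEquivOfSurjective hs
  have he : ∀ t, e.symm (Y.nicholsMk t) = Submodule.Quotient.mk t := fun t => by
    rw [LinearEquiv.symm_apply_eq]; rfl
  let F : ι → Y.Nichols →ₗ[k] k := fun i =>
    (Submodule.liftQ _ (Y.pairing b (w i)) (hk (w i))) ∘ₗ e.symm.toLinearMap
  have hF : ∀ i j, F i (Y.nicholsMon b (w j)) = Y.pairing b (w i) (mon b (w j)) := by
    intro i j
    have := congrArg (Submodule.liftQ _ (Y.pairing b (w i)) (hk (w i))) (he (mon b (w j)))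
    exact this
  refine linearIndependent_of_functionals _ F h (fun i => ?_) (fun i j => ?_)
  · rw [hF]; exact h1 i
  · rw [hF]; exact h2 i j

theorem range_ι_pow (b : Module.Basis Letter k V) (n : ℕ) :
    LinearMap.range (TensorAlgebra.ι k : V →ₗ[k] _) ^ n =
      Submodule.span k (mon b '' {w | w.length = n}) := by
  have h1 : LinearMap.range (TensorAlgebra.ι k : V →ₗ[k] _) =
      Submodule.span k (Set.range fun i => TensorAlgebra.ι k (b i)) := by
    rw [LinearMap.range_eq_map, ← b.span_eq, Submodule.map_span, ← Set.range_comp]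
    rfl
  induction n with
  | zero =>
    have : mon b '' {w | w.length = 0} = {1} := by
      simp [mon, eval]
    rw [this, pow_zero, Submodule.one_eq_span]
  | succ n ih =>
    rw [pow_succ', ih, h1, Submodule.span_mul_span]
    congr 1
    ext t
    constructor
    · rintro ⟨_, ⟨i, rfl⟩, _, ⟨w, hw, rfl⟩, rfl⟩
      refine ⟨i :: w, ?_, by simp [mon, eval]⟩
      simpa using hw
    · rintro ⟨w, hw, rfl⟩
      cases w with
      | nil => simp at hw
      | cons i w =>
        refine ⟨_, ⟨i, rfl⟩, mon b w, ⟨w, ?_, rfl⟩, by simp [mon, eval]⟩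
        simpa using hw

theorem nicholsDegree_eq_span (b : Module.Basis Letter k V) (n : ℕ) :
    Y.nicholsDegree n = Submodule.span k (Y.nicholsMon b '' {w | w.length = n}) := by
  rw [nicholsDegree, range_ι_pow b, Submodule.map_span, ← Set.image_comp]
  rfl

theorem span_nicholsMon (b : Module.Basis Letter k V) :
    Submodule.span k (Set.range (Y.nicholsMon b)) = ⊤ := by
  rw [eq_top_iff]
  rintro z -
  obtain ⟨t, rfl⟩ := Ideal.Quotient.mk_surjective z
  change Y.nicholsMk t ∈ _
  induction t using DirectSum.Decomposition.inductionOn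
    ((LinearMap.range (TensorAlgebra.ι k : V →ₗ[k] _) ^ ·) : ℕ → Submodule k _) with
  | zero => simp
  | add a b ha hb => rw [map_add]; exact add_mem ha hb
  | @homogeneous n a =>
    have h : Y.nicholsMk a ∈ Y.nicholsDegree n := Submodule.mem_map_of_mem a.2
    rw [Y.nicholsDegree_eq_span b] at h
    exact Submodule.span_mono (Set.image_subset_range _ _) h

end YetterDrinfeld

namespace Letter

/-! ### A Gröbner basis of the quadratic relations -/

/-- The quadratic relations, solved for their leading words; `s` is a sign. -/
structure QuadraticRelations {A : Type*} [Ring A] (s : ℤ) (y : Letter → A) : Prop where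
  rel11 : y l₁ * y l₁ = 0
  rel22 : y l₂ * y l₂ = 0
  rel31 : y l₃ * y l₁ = -(y l₂ * y l₃) + s • (y l₁ * y l₂)
  rel32 : y l₃ * y l₂ = s • (y l₂ * y l₁) - y l₁ * y l₃
  rel33 : y l₃ * y l₃ = 0
  rel35 : y l₃ * y l₅ = s • (y l₅ * y l₃)
  rel41 : y l₄ * y l₁ = s • (y l₁ * y l₄)
  rel42 : y l₄ * y l₂ = s • (y l₅ * y l₄) + s • (y l₂ * y l₅)
  rel44 : y l₄ * y l₄ = 0
  rel45 : y l₄ * y l₅ = -(y l₅ * y l₂) + s • (y l₂ * y l₄)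
  rel55 : y l₅ * y l₅ = 0
  rel61 : y l₆ * y l₁ = -(y l₅ * y l₆) + s • (y l₁ * y l₅)
  rel62 : y l₆ * y l₂ = s • (y l₂ * y l₆)
  rel63 : y l₆ * y l₃ = -(y l₄ * y l₆) + s • (y l₃ * y l₄)
  rel64 : y l₆ * y l₄ = s • (y l₄ * y l₃) - y l₃ * y l₆
  rel65 : y l₆ * y l₅ = s • (y l₅ * y l₁) - y l₁ * y l₆
  rel66 : y l₆ * y l₆ = 0

namespace QuadraticRelations

variable {A : Type*} [Ring A] {s : ℤ} {y : Letter → A} (h : QuadraticRelations s y)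
  (hs : s = 1 ∨ s = -1)

include h hs

/-- This and the following relations resolve overlaps of two leading words, each reduced in both
possible ways. The overlaps in degree three are l₃l₁l₁ here, then l₆l₁l₁, l₄l₅l₅ and l₆l₃l₃. -/
theorem rel212 : y l₂ * y l₁ * y l₂ = y l₁ * y l₂ * y l₁ := by
  rcases hs with rfl | rfl
  · linear_combination (norm := noncomm_ring)
      h.rel31 * y l₁ + h.rel22 * y l₃ - y l₃ * h.rel11 - y l₂ * h.rel31
  · linear_combination (norm := noncomm_ring)
      y l₃ * h.rel11 + y l₂ * h.rel31 - h.rel31 * y l₁ - h.rel22 * y l₃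

theorem rel515 : y l₅ * y l₁ * y l₅ = y l₁ * y l₅ * y l₁ := by
  rcases hs with rfl | rfl
  · linear_combination (norm := noncomm_ring)
      h.rel61 * y l₁ + h.rel55 * y l₆ - y l₆ * h.rel11 - y l₅ * h.rel61
  · linear_combination (norm := noncomm_ring)
      y l₆ * h.rel11 + y l₅ * h.rel61 - h.rel61 * y l₁ - h.rel55 * y l₆

theorem rel525 : y l₅ * y l₂ * y l₅ = -s • (y l₂ * y l₅ * y l₂) := by
  rcases hs with rfl | rfl
  · linear_combination (norm := noncomm_ring)
      h.rel45 * y l₅ + y l₂ * h.rel45 + h.rel22 * y l₄ - y l₄ * h.rel55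
  · linear_combination (norm := noncomm_ring)
      h.rel45 * y l₅ + h.rel22 * y l₄ - y l₄ * h.rel55 - y l₂ * h.rel45

theorem rel434 : y l₄ * y l₃ * y l₄ = y l₃ * y l₄ * y l₃ := by
  rcases hs with rfl | rfl
  · linear_combination (norm := noncomm_ring)
      h.rel63 * y l₃ + h.rel44 * y l₆ - y l₆ * h.rel33 - y l₄ * h.rel63
  · linear_combination (norm := noncomm_ring)
      y l₆ * h.rel33 + y l₄ * h.rel63 - h.rel63 * y l₃ - h.rel44 * y l₆

/-- From the overlap l₆l₅l₂l₅ of l₆l₅ with l₅l₂l₅; `rel5215` comes likewise from l₄l₅l₁l₅. -/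
theorem rel5125 : y l₅ * y l₁ * y l₂ * y l₅ = -(y l₂ * y l₅ * y l₁ * y l₂) + s • (y l₁ * y l₂
  * y l₅ * y l₁) := by
  rcases hs with rfl | rfl
  · linear_combination (norm := noncomm_ring)
      y l₆ * (h.rel525 (.inl rfl)) + y l₂ * y l₁ * h.rel62 + (h.rel212 (.inl rfl)) * y l₆ +
      y l₁ * h.rel62 * y l₅ + y l₁ * y l₂ * h.rel65 - h.rel65 * y l₂ * y l₅ - h.rel62 * y l₅
      * y l₂ - y l₂ * h.rel65 * y l₂
  · linear_combination (norm := noncomm_ring)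
      h.rel65 * y l₂ * y l₅ + y l₂ * h.rel65 * y l₂ + (h.rel212 (.inr rfl)) * y l₆ + y l₁ *
      y l₂ * h.rel65 - y l₆ * (h.rel525 (.inr rfl)) - h.rel62 * y l₅ * y l₂ - y l₂ * y l₁ *
      h.rel62 - y l₁ * h.rel62 * y l₅

theorem rel5215 : y l₅ * y l₂ * y l₁ * y l₅ = -(y l₂ * y l₁ * y l₅ * y l₂) + s • (y l₁ * y l₅
  * y l₂ * y l₁) := by
  rcases hs with rfl | rfl
  · linear_combination (norm := noncomm_ring)
      h.rel45 * y l₁ * y l₅ + y l₂ * h.rel41 * y l₅ + y l₂ * y l₁ * h.rel45 + (h.rel212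
      (.inl rfl)) * y l₄ - y l₄ * (h.rel515 (.inl rfl)) - h.rel41 * y l₅ * y l₁ - y l₁ *
      h.rel45 * y l₁ - y l₁ * y l₂ * h.rel41
  · linear_combination (norm := noncomm_ring)
      h.rel45 * y l₁ * y l₅ + y l₂ * y l₁ * h.rel45 + y l₁ * h.rel45 * y l₁ - y l₄ *
      (h.rel515 (.inr rfl)) - h.rel41 * y l₅ * y l₁ - y l₂ * h.rel41 * y l₅ - (h.rel212
      (.inr rfl)) * y l₄ - y l₁ * y l₂ * h.rel41

/-- From the overlap l₅l₁l₅l₂l₁l₅ of l₅l₁l₅ with l₅l₂l₁l₅; `rel512151` uses l₅l₂l₅l₁l₂l₅. -/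
theorem rel512152 : y l₅ * y l₁ * y l₂ * y l₁ * y l₅ * y l₂ = -(y l₁ * y l₅ * y l₁ * y l₂ * y
  l₁ * y l₅) := by
  rcases hs with rfl | rfl
  · linear_combination (norm := noncomm_ring)
      y l₅ * y l₁ * (h.rel5215 (.inl rfl)) + y l₅ * h.rel11 * y l₅ * y l₂ * y l₁ - (h.rel515
      (.inl rfl)) * y l₂ * y l₁ * y l₅
  · linear_combination (norm := noncomm_ring)
      y l₅ * y l₁ * (h.rel5215 (.inr rfl)) - (h.rel515 (.inr rfl)) * y l₂ * y l₁ * y l₅ - y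
      l₅ * h.rel11 * y l₅ * y l₂ * y l₁

theorem rel512151 : y l₅ * y l₁ * y l₂ * y l₁ * y l₅ * y l₁ = -(y l₂ * y l₅ * y l₁ * y l₂ * y
  l₁ * y l₅) := by
  rcases hs with rfl | rfl
  · linear_combination (norm := noncomm_ring)
      (h.rel525 (.inl rfl)) * y l₁ * y l₂ * y l₅ + y l₅ * h.rel22 * y l₅ * y l₁ * y l₂ - y
      l₅ * y l₂ * (h.rel5125 (.inl rfl)) - y l₅ * (h.rel212 (.inl rfl)) * y l₅ * y l₁ - y l₂
      * y l₅ * (h.rel212 (.inl rfl)) * y l₅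
  · linear_combination (norm := noncomm_ring)
      y l₅ * y l₂ * (h.rel5125 (.inr rfl)) - (h.rel525 (.inr rfl)) * y l₁ * y l₂ * y l₅ - y
      l₅ * h.rel22 * y l₅ * y l₁ * y l₂ - y l₅ * (h.rel212 (.inr rfl)) * y l₅ * y l₁ - y l₂
      * y l₅ * (h.rel212 (.inr rfl)) * y l₅

end QuadraticRelations

end Letter

/-! ### The quadratic relations in the Nichols algebra -/

open Letter

/-- The coefficients of the action of the transpositions, normalised such that the coefficients
are signs; `s` is the coefficient for commuting transpositions. -/
def signTable {k : Type*} [Ring k] (s : k) : Letter → Letter → k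
  | l₁ => table (-1) s s s s s
  | l₂ => table s (-1) s s s s
  | l₃ => table (-1) (-1) (-1) s s s
  | l₄ => table s s s (-1) s s
  | l₅ => table s (-1) s (-1) (-1) s
  | l₆ => table (-1) s (-1) (-1) (-1) (-1)

namespace YetterDrinfeld

variable {k G V : Type*} [Field k] [Group G] [AddCommGroup V] [Module k V]
  {Y : YetterDrinfeld k G V}

/-- The two middle terms are the obstruction to primitivity. They encode (1 + c)(u ⊗ w) for the
braiding c, so the relations sought are the quadratic elements killed by 1 + c. -/
theorem lift_mulPrimitive_mul {g h : G} {u w : V} (hu : u ∈ Y.component g)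
    (hw : w ∈ Y.component h) (c d : TensorAlgebra k V) :
    TensorAlgebra.lift k Y.mulPrimitive (TensorAlgebra.ι k u * TensorAlgebra.ι k w) (c ⊗ₜ[k] d) =
      (TensorAlgebra.ι k u * (TensorAlgebra.ι k w * c)) ⊗ₜ[k] d +
      (TensorAlgebra.ι k (Y.rep g w) * Y.tensorAct g c) ⊗ₜ[k] (TensorAlgebra.ι k u * d) +
      (TensorAlgebra.ι k u * Y.tensorAct h c) ⊗ₜ[k] (TensorAlgebra.ι k w * d) +
      Y.tensorAct (g * h) c ⊗ₜ[k] (TensorAlgebra.ι k u * (TensorAlgebra.ι k w * d)) := by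
  rw [map_mul, Module.End.mul_apply, TensorAlgebra.lift_ι_apply, TensorAlgebra.lift_ι_apply,
    Y.mulPrimitive_tmul_of_mem hw, map_add, Y.mulPrimitive_tmul_of_mem hu,
    Y.mulPrimitive_tmul_of_mem hu, map_mul, tensorAct_ι, tensorAct_mul_apply]
  abel

namespace IsLetterBasis

variable {x : Letter → G} {q : Letter → Letter → k} {b : Module.Basis Letter k V}
  (hb : Y.IsLetterBasis x q b)

include hb

theorem mul_mem_quadraticComponent (i j : Letter) {g : G} (hg : x i * x j = g) :
    TensorAlgebra.ι k (b i) * TensorAlgebra.ι k (b j) ∈ Y.quadraticComponent g :=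
  Submodule.subset_span ⟨x i, x j, hg, b i, hb.mem i, b j, hb.mem j, rfl⟩

theorem toNichols_mul_self (i : Letter) (hq : q i i = -1) :
    Y.toNichols (b i) * Y.toNichols (b i) = 0 := by
  have : Y.IsQuadraticPrimitive (x i * x i)
      (TensorAlgebra.ι k (b i) * TensorAlgebra.ι k (b i)) := by
    refine ⟨hb.mul_mem_quadraticComponent i i rfl, fun c d => ?_⟩
    rw [lift_mulPrimitive_mul (hb.mem i) (hb.mem i), hb.rep, hq, act_self, neg_one_smul, map_neg,
      neg_mul, TensorProduct.neg_tmul, mul_assoc, mul_assoc]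
    abel
  have h := (Y.nicholsMk_eq_zero _).2 (this.mem_nicholsIdeal Y)
  rwa [map_mul] at h

theorem toNichols_mul_comm (hx : ∀ i j, x i * x j = x (act i j) * x i) {i j : Letter}
    (hij : act i j = j) (hji : act j i = i) (hq : q i j * q j i = 1) :
    Y.toNichols (b i) * Y.toNichols (b j) =
      q i j • (Y.toNichols (b j) * Y.toNichols (b i)) := by
  have e : x j * x i = x i * x j := by rw [hx i j, hij]
  have : Y.IsQuadraticPrimitive (x i * x j)
      (TensorAlgebra.ι k (b i) * TensorAlgebra.ι k (b j) -
        q i j • (TensorAlgebra.ι k (b j) * TensorAlgebra.ι k (b i))) := by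
    refine ⟨sub_mem (hb.mul_mem_quadraticComponent i j rfl)
      (Submodule.smul_mem _ _ (hb.mul_mem_quadraticComponent j i e)), fun c d => ?_⟩
    rw [map_sub, map_smul, LinearMap.sub_apply, LinearMap.smul_apply,
      lift_mulPrimitive_mul (hb.mem i) (hb.mem j), lift_mulPrimitive_mul (hb.mem j) (hb.mem i),
      hb.rep, hb.rep, hij, hji, e]
    simp only [map_smul, smul_mul_assoc, ← TensorProduct.smul_tmul', TensorProduct.tmul_smul,
      sub_mul, TensorProduct.sub_tmul, TensorProduct.tmul_sub, mul_assoc, smul_add, smul_smul, hq]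
    module
  have h := (Y.nicholsMk_eq_zero _).2 (this.mem_nicholsIdeal Y)
  rw [map_sub, map_smul, map_mul, map_mul, sub_eq_zero] at h
  exact h

/-- The braiding permutes b_i ⊗ b_j, b_l ⊗ b_i, b_j ⊗ b_l cyclically up to scalars, and `hq` says
that c³ = -1 on their span. Hence (1 - c + c²)(b_i ⊗ b_j) is killed by 1 + c. -/
theorem toNichols_mul_braid (hx : ∀ i j, x i * x j = x (act i j) * x i) {i j l : Letter}
    (hij : act i j = l) (hli : act l i = j) (hjl : act j l = i)
    (hq : q i j * q l i * q j l = -1) :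
    Y.toNichols (b i) * Y.toNichols (b j) =
      q i j • (Y.toNichols (b l) * Y.toNichols (b i)) -
        (q i j * q l i) • (Y.toNichols (b j) * Y.toNichols (b l)) := by
  have e1 : x l * x i = x i * x j := by rw [hx i j, hij]
  have e2 : x j * x l = x i * x j := by rw [← e1, hx l i, hli]
  have : Y.IsQuadraticPrimitive (x i * x j)
      (TensorAlgebra.ι k (b i) * TensorAlgebra.ι k (b j) -
        (q i j • (TensorAlgebra.ι k (b l) * TensorAlgebra.ι k (b i)) -
          (q i j * q l i) • (TensorAlgebra.ι k (b j) * TensorAlgebra.ι k (b l)))) := by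
    refine ⟨sub_mem (hb.mul_mem_quadraticComponent i j rfl) (sub_mem
      (Submodule.smul_mem _ _ (hb.mul_mem_quadraticComponent l i e1))
      (Submodule.smul_mem _ _ (hb.mul_mem_quadraticComponent j l e2))), fun c d => ?_⟩
    rw [map_sub, map_sub, map_smul, map_smul, LinearMap.sub_apply, LinearMap.sub_apply,
      LinearMap.smul_apply, LinearMap.smul_apply,
      lift_mulPrimitive_mul (hb.mem i) (hb.mem j), lift_mulPrimitive_mul (hb.mem l) (hb.mem i),
      lift_mulPrimitive_mul (hb.mem j) (hb.mem l),
      hb.rep, hb.rep, hb.rep, hij, hli, hjl, e1, e2]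
    simp only [map_smul, smul_mul_assoc, ← TensorProduct.smul_tmul', TensorProduct.tmul_smul,
      sub_mul, TensorProduct.sub_tmul, TensorProduct.tmul_sub, mul_assoc, smul_add, smul_smul]
    rw [← mul_assoc (q i j), hq]
    module
  have h := (Y.nicholsMk_eq_zero _).2 (this.mem_nicholsIdeal Y)
  rw [map_sub, map_sub, map_smul, map_smul, map_mul, map_mul, map_mul, sub_eq_zero] at h
  exact h

/-- There is one relation per orbit of the braiding on pairs of labels: six squares, three pairs of
commuting transpositions and eight orbits of length three. Each is solved for its leading word. -/
theorem quadraticRelations (hx : ∀ i j, x i * x j = x (act i j) * x i) {s : ℤ}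
    (hs : s = 1 ∨ s = -1) (hq : ∀ i j, q i j = signTable (s : k) i j) :
    QuadraticRelations s fun i => Y.toNichols (b i) := by
  have hs' : (s : k) * s = 1 := by rcases hs with rfl | rfl <;> simp
  have comm : ∀ i j, act i j = j → act j i = i → i ≠ j →
      Y.toNichols (b i) * Y.toNichols (b j) =
        s • (Y.toNichols (b j) * Y.toNichols (b i)) := by
    intro i j hij hji hne
    have e : q i j = s ∧ q j i = s := by
      rw [hq, hq]
      revert hij hji hne
      cases i <;> cases j <;> simp [act, table, signTable]
    rw [hb.toNichols_mul_comm hx hij hji (by rw [e.1, e.2, hs']), e.1, Int.cast_smul_eq_zsmul]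
  have sq : ∀ i, Y.toNichols (b i) * Y.toNichols (b i) = 0 := fun i =>
    hb.toNichols_mul_self i (by rw [hq]; cases i <;> rfl)
  have braid : ∀ i j, act i j ≠ j → Y.toNichols (b i) * Y.toNichols (b j) =
      signTable s i j • (Y.toNichols (b (act i j)) * Y.toNichols (b i)) -
        (signTable s i j * signTable s (act i j) i) •
          (Y.toNichols (b j) * Y.toNichols (b (act i j))) := by
    intro i j hij
    have e : act (act i j) i = j ∧ act j (act i j) = i := by
      revert hij
      cases i <;> cases j <;> simp [act, table]
    have e' : signTable s i j * signTable s (act i j) i * signTable s j (act i j) = -1 := by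
      revert hij
      rcases hs with rfl | rfl <;> cases i <;> cases j <;> simp [act, table, signTable]
    -- All coefficients are images of integers, so the sign computations take place in ℤ and cover
    -- every characteristic, including two.
    have hcast : ∀ i j, q i j = (signTable s i j : ℤ) := by
      intro i j
      rw [hq]
      cases i <;> cases j <;> simp [signTable, table]
    have := hb.toNichols_mul_braid hx rfl e.1 e.2 (by
      rw [hcast, hcast, hcast, ← Int.cast_mul, ← Int.cast_mul, e', Int.cast_neg, Int.cast_one])
    rw [this, hcast, hcast, ← Int.cast_mul, Int.cast_smul_eq_zsmul, Int.cast_smul_eq_zsmul]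
  have fin : ∀ (i j : Letter) (z : Y.Nichols), act i j ≠ j →
      signTable s i j • (Y.toNichols (b (act i j)) * Y.toNichols (b i)) -
        (signTable s i j * signTable s (act i j) i) •
          (Y.toNichols (b j) * Y.toNichols (b (act i j))) = z →
      Y.toNichols (b i) * Y.toNichols (b j) = z := fun i j z h h' => (braid i j h).trans h'
  constructor
  · exact sq _
  · exact sq _
  · exact fin _ _ _ (by simp [act, table])
      (by
        rcases hs with rfl | rfl <;> simp [signTable, act, table]
        abel)
  · exact fin _ _ _ (by simp [act, table])
      (by rcases hs with rfl | rfl <;> simp [signTable, act, table] <;> abel)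
  · exact sq _
  · exact comm _ _ rfl rfl (by simp)
  · exact comm _ _ rfl rfl (by simp)
  · exact fin _ _ _ (by simp [act, table])
      (by
        rcases hs with rfl | rfl <;> simp [signTable, act, table]
        abel)
  · exact sq _
  · exact fin _ _ _ (by simp [act, table])
      (by rcases hs with rfl | rfl <;> simp [signTable, act, table] <;> abel)
  · exact sq _
  · exact fin _ _ _ (by simp [act, table])
      (by
        rcases hs with rfl | rfl <;> simp [signTable, act, table]
        abel)
  · exact comm _ _ rfl rfl (by simp)
  · exact fin _ _ _ (by simp [act, table])
      (by
        rcases hs with rfl | rfl <;> simp [signTable, act, table]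
        abel)
  · exact fin _ _ _ (by simp [act, table])
      (by rcases hs with rfl | rfl <;> simp [signTable, act, table] <;> abel)
  · exact fin _ _ _ (by simp [act, table])
      (by rcases hs with rfl | rfl <;> simp [signTable, act, table] <;> abel)
  · exact sq _

end IsLetterBasis
end YetterDrinfeld

namespace Letter

theorem eval_mem_of_eq_sum {k A : Type*} [Field k] [Ring A] [Algebra k A] {y : Letter → A}
    {f : List Letter} (C : List ℤ) (L : List (List Letter))
    (hL : ∀ u ∈ L, u.length = f.length ∧ value u < value f)
    (h : eval y f = (List.zipWith (fun c u => c • eval y u) C L).sum) :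
    eval y f ∈ Submodule.span k (eval y '' {u | u.length = f.length ∧ value u < value f}) := by
  rw [h]
  clear h
  induction L generalizing C with
  | nil => simp
  | cons u L ih =>
    cases C with
    | nil => simp
    | cons c C =>
      rw [List.zipWith_cons_cons, List.sum_cons]
      refine add_mem ?_ (ih C fun p hp => hL p (List.mem_cons_of_mem _ hp))
      have : eval y u ∈
          Submodule.span k (eval y '' {u | u.length = f.length ∧ value u < value f}) :=
        Submodule.subset_span ⟨u, hL u List.mem_cons_self, rfl⟩
      exact zsmul_mem this c

namespace QuadraticRelations

variable {A : Type*} [Ring A] {s : ℤ} {y : Letter → A} (h : QuadraticRelations s y)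
  (hs : s = 1 ∨ s = -1)

include h hs

theorem eval_leadingWord (k : Type*) [Field k] [Algebra k A] {f : List Letter}
    (hf : f ∈ leadingWords) :
    eval y f ∈ Submodule.span k (eval y '' {u | u.length = f.length ∧ value u < value f}) := by
  simp only [leadingWords, List.mem_cons, List.not_mem_nil, or_false] at hf
  rcases hf with rfl | rfl | rfl | rfl | rfl | rfl | rfl | rfl | rfl | rfl | rfl | rfl | rfl | rfl |
    rfl | rfl | rfl | rfl | rfl | rfl | rfl | rfl | rfl | rfl | rfl
  · exact eval_mem_of_eq_sum [] [] (by decide)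
      (by simpa [eval, mul_assoc, sub_eq_add_neg] using h.rel11)
  · exact eval_mem_of_eq_sum [-1, s] [[l₂, l₃], [l₁, l₂]] (by decide)
      (by simpa [eval, mul_assoc, sub_eq_add_neg] using h.rel31)
  · exact eval_mem_of_eq_sum [s, -1] [[l₂, l₁], [l₁, l₃]] (by decide)
      (by simpa [eval, mul_assoc, sub_eq_add_neg] using h.rel32)
  · exact eval_mem_of_eq_sum [s] [[l₁, l₄]] (by decide)
      (by simpa [eval, mul_assoc, sub_eq_add_neg] using h.rel41)
  · exact eval_mem_of_eq_sum [-1, s] [[l₅, l₆], [l₁, l₅]] (by decide)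
      (by simpa [eval, mul_assoc, sub_eq_add_neg] using h.rel61)
  · exact eval_mem_of_eq_sum [s, -1] [[l₅, l₁], [l₁, l₆]] (by decide)
      (by simpa [eval, mul_assoc, sub_eq_add_neg] using h.rel65)
  · exact eval_mem_of_eq_sum [] [] (by decide)
      (by simpa [eval, mul_assoc, sub_eq_add_neg] using h.rel22)
  · exact eval_mem_of_eq_sum [-1, s] [[l₅, l₂], [l₂, l₄]] (by decide)
      (by simpa [eval, mul_assoc, sub_eq_add_neg] using h.rel45)
  · exact eval_mem_of_eq_sum [s, s] [[l₅, l₄], [l₂, l₅]] (by decide)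
      (by simpa [eval, mul_assoc, sub_eq_add_neg] using h.rel42)
  · exact eval_mem_of_eq_sum [s] [[l₂, l₆]] (by decide)
      (by simpa [eval, mul_assoc, sub_eq_add_neg] using h.rel62)
  · exact eval_mem_of_eq_sum [] [] (by decide)
      (by simpa [eval, mul_assoc, sub_eq_add_neg] using h.rel33)
  · exact eval_mem_of_eq_sum [-1, s] [[l₄, l₆], [l₃, l₄]] (by decide)
      (by simpa [eval, mul_assoc, sub_eq_add_neg] using h.rel63)
  · exact eval_mem_of_eq_sum [s] [[l₅, l₃]] (by decide)
      (by simpa [eval, mul_assoc, sub_eq_add_neg] using h.rel35)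
  · exact eval_mem_of_eq_sum [s, -1] [[l₄, l₃], [l₃, l₆]] (by decide)
      (by simpa [eval, mul_assoc, sub_eq_add_neg] using h.rel64)
  · exact eval_mem_of_eq_sum [] [] (by decide)
      (by simpa [eval, mul_assoc, sub_eq_add_neg] using h.rel44)
  · exact eval_mem_of_eq_sum [] [] (by decide)
      (by simpa [eval, mul_assoc, sub_eq_add_neg] using h.rel55)
  · exact eval_mem_of_eq_sum [] [] (by decide)
      (by simpa [eval, mul_assoc, sub_eq_add_neg] using h.rel66)
  · exact eval_mem_of_eq_sum [1] [[l₁, l₂, l₁]] (by decide)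
      (by simpa [eval, mul_assoc, sub_eq_add_neg] using h.rel212 hs)
  · exact eval_mem_of_eq_sum [1] [[l₁, l₅, l₁]] (by decide)
      (by simpa [eval, mul_assoc, sub_eq_add_neg] using h.rel515 hs)
  · exact eval_mem_of_eq_sum [-s] [[l₂, l₅, l₂]] (by decide)
      (by simpa [eval, mul_assoc, sub_eq_add_neg] using h.rel525 hs)
  · exact eval_mem_of_eq_sum [1] [[l₃, l₄, l₃]] (by decide)
      (by simpa [eval, mul_assoc, sub_eq_add_neg] using h.rel434 hs)
  · exact eval_mem_of_eq_sum [-1, s] [[l₂, l₅, l₁, l₂], [l₁, l₂, l₅, l₁]] (by decide)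
      (by simpa [eval, mul_assoc, sub_eq_add_neg] using h.rel5125 hs)
  · exact eval_mem_of_eq_sum [-1, s] [[l₂, l₁, l₅, l₂], [l₁, l₅, l₂, l₁]] (by decide)
      (by simpa [eval, mul_assoc, sub_eq_add_neg] using h.rel5215 hs)
  · exact eval_mem_of_eq_sum [-1] [[l₁, l₅, l₁, l₂, l₁, l₅]] (by decide)
      (by simpa [eval, mul_assoc, sub_eq_add_neg] using h.rel512152 hs)
  · exact eval_mem_of_eq_sum [-1] [[l₂, l₅, l₁, l₂, l₁, l₅]] (by decide)
      (by simpa [eval, mul_assoc, sub_eq_add_neg] using h.rel512151 hs)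

end QuadraticRelations
end Letter

/-! ### The monomial basis, the Hilbert series and the integral -/

namespace YetterDrinfeld

variable {k G V : Type*} [Field k] [Group G] [AddCommGroup V] [Module k V]
  {Y : YetterDrinfeld k G V}

namespace IsLetterBasis

variable {x : Letter → G} {q : Letter → Letter → k} {b : Module.Basis Letter k V}
  (hb : Y.IsLetterBasis x q b)

include hb

/-- All degrees are treated at once: words of different lengths do not reach each other, so their
pairings vanish. -/
theorem linearIndependent_normal :
    LinearIndependent k fun w : {w // normal w = true} => Y.nicholsMon b w := by
  refine Y.linearIndependent_nicholsMon b (fun w : {w // normal w = true} => w.1)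
    (fun w => height w.1) (fun w => ?_) (fun f w h => ?_)
  · rw [hb.pairing_mon_self (rigid_of_normal w.2)]
    exact one_ne_zero
  · rcases triangular_of_normal f.2 w.2 (by
      by_contra hr
      exact h (hb.pairing_mon_eq_zero (by simpa using hr))) with e | e
    · exact Or.inl (Subtype.ext e)
    · exact Or.inr e

variable (hx : ∀ i j, x i * x j = x (act i j) * x i) {s : ℤ} (hs : s = 1 ∨ s = -1)
  (hq : ∀ i j, q i j = signTable (s : k) i j)

include hx hs hq

theorem nicholsMon_mem_span (w : List Letter) : Y.nicholsMon b w ∈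
    Submodule.span k (Y.nicholsMon b '' {u | normal u = true ∧ u.length = w.length}) := by
  have he : Y.nicholsMon b = eval fun i => Y.toNichols (b i) :=
    funext (Y.nicholsMon_eq_eval b)
  rw [he]
  exact eval_mem_span_normal _
    (fun f hf => (hb.quadraticRelations hx hs hq).eval_leadingWord hs k hf) w

theorem nicholsDegree_eq_span_normal (n : ℕ) : Y.nicholsDegree n =
    Submodule.span k (Y.nicholsMon b '' {u | normal u = true ∧ u.length = n}) := by
  rw [Y.nicholsDegree_eq_span b]
  refine le_antisymm (Submodule.span_le.2 ?_)
    (Submodule.span_mono (Set.image_mono fun u hu => hu.2))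
  rintro _ ⟨w, rfl, rfl⟩
  exact hb.nicholsMon_mem_span hx hs hq w

theorem finrank_nicholsDegree (n : ℕ) : Module.finrank k (Y.nicholsDegree n) = count n := by
  let S : Finset (List Letter) := (normalWords n).toFinset
  have hS : ∀ w, w ∈ S ↔ normal w = true ∧ w.length = n := fun w => by
    rw [List.mem_toFinset, mem_normalWords]
  have hli : LinearIndependent k fun w : S => Y.nicholsMon b w :=
    hb.linearIndependent_normal.comp
      (fun w : S => (⟨w.1, ((hS w.1).1 w.2).1⟩ : {w // normal w = true}))
      (fun w w' h => Subtype.ext (by simpa using h))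
  have hspan : Y.nicholsDegree n = Submodule.span k (Set.range fun w : S => Y.nicholsMon b w) := by
    rw [hb.nicholsDegree_eq_span_normal hx hs hq]
    congr 1
    ext z
    constructor
    · rintro ⟨w, hw, rfl⟩
      exact ⟨⟨w, (hS w).2 hw⟩, rfl⟩
    · rintro ⟨w, rfl⟩
      exact ⟨w, (hS w).1 w.2, rfl⟩
  rw [hspan, finrank_span_eq_card hli, Fintype.card_coe,
    List.toFinset_card_of_nodup (nodup_normalWords n), count]

theorem finrank_nichols : Module.finrank k Y.Nichols = 576 := by
  let S : Finset (List Letter) := (Finset.range 13).biUnion fun n => (normalWords n).toFinset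
  have hS : ∀ w, w ∈ S ↔ normal w = true := fun w => by
    simp only [S, Finset.mem_biUnion, Finset.mem_range, List.mem_toFinset, mem_normalWords]
    constructor
    · rintro ⟨n, -, h, -⟩; exact h
    · exact fun h => ⟨_, length_lt_of_normal h, h, rfl⟩
  have hli : LinearIndependent k fun w : S => Y.nicholsMon b w :=
    hb.linearIndependent_normal.comp
      (fun w : S => (⟨w.1, (hS w.1).1 w.2⟩ : {w // normal w = true}))
      (fun w w' h => Subtype.ext (by simpa using h))
  have hspan : Submodule.span k (Set.range fun w : S => Y.nicholsMon b w) = ⊤ := by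
    rw [eq_top_iff, ← Y.span_nicholsMon b, Submodule.span_le]
    rintro _ ⟨w, rfl⟩
    refine Submodule.span_mono ?_ (hb.nicholsMon_mem_span hx hs hq w)
    rintro _ ⟨u, hu, rfl⟩
    exact ⟨⟨u, (hS u).2 hu.1⟩, rfl⟩
  have hcard : S.card = 576 := by
    rw [Finset.card_biUnion]
    · have h1 : ∀ n, (normalWords n).toFinset.card = count n := fun n =>
        List.toFinset_card_of_nodup (nodup_normalWords n)
      have hc := count_eq
      simp only [List.cons.injEq, and_true] at hc
      obtain ⟨h0, h1', h2, h3, h4, h5, h6, h7, h8, h9, h10, h11, h12, -⟩ := hc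
      simp only [h1, Finset.sum_range_succ, Finset.sum_range_zero, h0, h1', h2, h3, h4, h5, h6,
        h7, h8, h9, h10, h11, h12]
    · intro m _ n _ hmn
      rw [Function.onFun, Finset.disjoint_left]
      intro w hw hw'
      rw [List.mem_toFinset, mem_normalWords] at hw hw'
      exact hmn (hw.2.symm.trans hw'.2)
  rw [← finrank_top, ← hspan, finrank_span_eq_card hli, Fintype.card_coe, hcard]

theorem hilbertSeries_eq : Y.hilbertSeries = qInt 2 ^ 2 * qInt 3 ^ 2 * qInt 4 ^ 2 := by
  have hc := count_eq
  simp only [List.cons.injEq, and_true] at hc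
  obtain ⟨h0, h1, h2, h3, h4, h5, h6, h7, h8, h9, h10, h11, h12, -⟩ := hc
  have hpoly : (qInt 2 ^ 2 * qInt 3 ^ 2 * qInt 4 ^ 2 : PowerSeries ℤ) =
      ∑ n ∈ Finset.range 13, (count n : ℤ) • PowerSeries.X ^ n := by
    simp only [qInt, Finset.sum_range_succ, Finset.sum_range_zero, h0, h1, h2, h3, h4, h5, h6, h7,
      h8, h9, h10, h11, h12, zsmul_eq_mul]
    push_cast
    ring
  rw [hpoly]
  ext n
  rw [hilbertSeries, PowerSeries.coeff_mk, hb.finrank_nicholsDegree hx hs hq, map_sum]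
  simp only [map_zsmul, PowerSeries.coeff_X_pow, smul_eq_mul, mul_ite, mul_one, mul_zero,
    Finset.sum_ite_eq, Finset.mem_range]
  split_ifs with hn
  · rfl
  · obtain ⟨m, rfl⟩ := Nat.exists_eq_add_of_le (not_lt.1 hn)
    rw [count, add_comm, normalWords_eq_nil]
    rfl

theorem nicholsDegree_thirteen : Y.nicholsDegree 13 = ⊥ := by
  rw [hb.nicholsDegree_eq_span_normal hx hs hq, Submodule.span_eq_bot]
  rintro _ ⟨w, ⟨hw, hl⟩, rfl⟩
  have := length_lt_of_normal hw
  omega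

/-- Multiplying by a generator on either side lands in degree 13, which is zero, and the monomial
itself is non-zero because it pairs to 1 with its own word. Rigidity is enough; the word need not be
normal. -/
theorem isHopfIntegral_nicholsMon {w : List Letter} (hw : rigid w = true) (hl : w.length = 12) :
    Y.IsHopfIntegral (Y.nicholsMon b w) := by
  have h13 : ∀ u : List Letter, u.length = 13 → Y.nicholsMon b u = 0 := by
    intro u hu
    have : Y.nicholsMon b u ∈ Y.nicholsDegree 13 := by
      rw [Y.nicholsDegree_eq_span b]
      exact Submodule.subset_span ⟨u, hu, rfl⟩
    rwa [hb.nicholsDegree_thirteen hx hs hq, Submodule.mem_bot] at this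
  have hcons : ∀ i u, Y.nicholsMon b (i :: u) = Y.toNichols (b i) * Y.nicholsMon b u := by
    intro i u
    simp [nicholsMon_eq_eval, eval]
  have hsnoc : ∀ i u, Y.nicholsMon b (u ++ [i]) = Y.nicholsMon b u * Y.toNichols (b i) := by
    intro i u
    simp [nicholsMon_eq_eval, eval]
  have hv : ∀ v : V, Y.toNichols v * Y.nicholsMon b w = 0 ∧
      Y.nicholsMon b w * Y.toNichols v = 0 := by
    intro v
    refine Submodule.span_induction (p := fun v _ => Y.toNichols v * Y.nicholsMon b w = 0 ∧
      Y.nicholsMon b w * Y.toNichols v = 0) ?_ (by simp)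
      (fun v v' _ _ h h' => by simp [add_mul, mul_add, h.1, h.2, h'.1, h'.2])
      (fun c v _ h => by simp [h.1, h.2]) (b.mem_span v)
    rintro _ ⟨i, rfl⟩
    rw [← hcons, ← hsnoc]
    exact ⟨h13 _ (by simp [hl]), h13 _ (by simp [hl])⟩
  constructor
  · intro h0
    have h1 := hb.pairing_mon_self hw
    rw [Y.pairing_eq_zero_of_mem b w ((Y.nicholsMk_eq_zero _).1 h0)] at h1
    exact zero_ne_one h1
  · intro z
    obtain ⟨t, rfl⟩ := Ideal.Quotient.mk_surjective z
    change Y.nicholsMk t * _ = Y.nicholsCounit (Y.nicholsMk t) • _ ∧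
      _ * Y.nicholsMk t = Y.nicholsCounit (Y.nicholsMk t) • _
    induction t using TensorAlgebra.induction with
    | algebraMap r => simp [Algebra.algebraMap_eq_smul_one]
    | ι v =>
      have : Y.nicholsCounit (Y.nicholsMk (TensorAlgebra.ι k v)) = 0 := by
        rw [nicholsCounit_mk, algebraMapInv_ι]
      rw [this, zero_smul]
      exact hv v
    | mul a c ha hc =>
      rw [map_mul, map_mul]
      constructor
      · rw [mul_assoc, hc.1, mul_smul_comm, ha.1, smul_smul, mul_comm]
      · rw [← mul_assoc, ha.2, smul_mul_assoc, hc.2, smul_smul]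
    | add a c ha hc =>
      rw [map_add, map_add, add_mul, mul_add, add_smul, ha.1, ha.2, hc.1, hc.2]
      exact ⟨rfl, rfl⟩

end IsLetterBasis
end YetterDrinfeld

/-! ### A lower bound in degree two -/

namespace Letter

/-- The normal words of length two together with the squares. -/
def quadraticWords : List (List Letter) :=
  [l₁, l₂, l₃, l₄, l₅, l₆].map (fun i => [i, i]) ++ normalWords 2

theorem triangular_quadraticWords : triangular height quadraticWords = true := by
  decide +kernel

theorem quadraticWords_card : quadraticWords.toFinset.card = 25 := by
  decide +kernel

theorem mem_quadraticWords {w : List Letter} (hw : w ∈ quadraticWords) :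
    w.length = 2 ∧ (rigid w = true ∨ ∃ i, w = [i, i]) := by
  rcases List.mem_append.1 hw with h | h
  · obtain ⟨i, -, rfl⟩ := List.mem_map.1 h
    exact ⟨rfl, Or.inr ⟨i, rfl⟩⟩
  · exact ⟨(mem_normalWords.1 h).2, Or.inl (rigid_of_normal (mem_normalWords.1 h).1)⟩

end Letter

namespace YetterDrinfeld

variable {k G V : Type*} [Field k] [Group G] [AddCommGroup V] [Module k V]
  {Y : YetterDrinfeld k G V}

theorem finiteDimensional_nicholsDegree (b : Module.Basis Letter k V) (n : ℕ) :
    FiniteDimensional k (Y.nicholsDegree n) := by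
  rw [Y.nicholsDegree_eq_span b]
  exact FiniteDimensional.span_of_finite k ((List.finite_length_eq Letter n).image _)

/-- The functional of a square takes the value 1 + q_ii ≠ 0 on it, so the triangular argument also
covers the six squares besides the 19 normal words. -/
theorem IsLetterBasis.le_finrank_nicholsDegree_two {x : Letter → G} {q : Letter → Letter → k}
    {b : Module.Basis Letter k V} (hb : Y.IsLetterBasis x q b) (hq : ∀ i, q i i ≠ -1) :
    25 ≤ Module.finrank k (Y.nicholsDegree 2) := by
  have hli : LinearIndependent k fun w : quadraticWords.toFinset => Y.nicholsMon b w := by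
    refine Y.linearIndependent_nicholsMon b
      (fun w : quadraticWords.toFinset => w.1) (fun w => height w.1) (fun w => ?_)
      (fun f w h => ?_)
    · rcases (mem_quadraticWords (List.mem_toFinset.1 w.2)).2 with h | ⟨i, h⟩
      · rw [hb.pairing_mon_self h]
        exact one_ne_zero
      · rw [h, hb.pairing_square]
        intro h0
        exact hq i (eq_neg_of_add_eq_zero_right h0)
    · rcases of_triangular triangular_quadraticWords (List.mem_toFinset.1 f.2)
        (List.mem_toFinset.1 w.2) (by
          by_contra hr
          exact h (hb.pairing_mon_eq_zero (by simpa using hr))) with e | e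
      · exact Or.inl (Subtype.ext e)
      · exact Or.inr e
  have := finrank_span_eq_card hli
  rw [Fintype.card_coe, quadraticWords_card] at this
  rw [← this]
  -- Monotonicity of `finrank` needs this, since `finrank` is 0 on infinite-dimensional spaces.
  have := finiteDimensional_nicholsDegree (Y := Y) b 2
  refine Submodule.finrank_mono (Submodule.span_le.2 ?_)
  rintro _ ⟨w, rfl⟩
  rw [Y.nicholsDegree_eq_span b]
  exact Submodule.subset_span ⟨w, (mem_quadraticWords (List.mem_toFinset.1 w.2)).1, rfl⟩

end YetterDrinfeld

/-! ### The enveloping group -/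

/-- The transposition with a given label. -/
def Letter.toRack : Letter → RackA := table π₁ π₂ π₃ π₄ π₅ π₆

theorem act_toRack (i j : Letter) :
    Shelf.act i.toRack j.toRack = (Letter.act i j).toRack := by
  apply Subtype.ext
  revert i j
  decide

theorem toRack_surjective : Function.Surjective Letter.toRack := by
  have h : ∀ g : Equiv.Perm (Fin 4), (∃ c : Equiv.Perm (Fin 4), c * Equiv.swap 0 1 * c⁻¹ = g) →
      ∃ i : Letter, i.toRack.1 = g := by decide
  rintro ⟨g, hg⟩
  obtain ⟨i, hi⟩ := h g (isConj_iff.1 hg)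
  exact ⟨i, Subtype.ext hi⟩

theorem gen_act (i j : RackA) : gen (Shelf.act i j) = gen i * gen j * (gen i)⁻¹ :=
  (Rack.toEnvelGroup RackA).map_act'

/-- The element `x_i` of the enveloping group. -/
def xgen (i : Letter) : GA := gen i.toRack

theorem xgen_mul (i j : Letter) : xgen i * xgen j = xgen (Letter.act i j) * xgen i := by
  rw [xgen, xgen, xgen, ← act_toRack, gen_act]
  group

theorem closure_range_gen : Subgroup.closure (Set.range gen) = ⊤ := by
  rw [eq_top_iff]
  rintro g -
  obtain ⟨a, rfl⟩ := Quotient.exists_rep g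
  induction a with
  | unit => exact one_mem _
  | incl i => exact Subgroup.subset_closure ⟨i, rfl⟩
  | mul a b ha hb => exact mul_mem ha hb
  | inv a ha => exact inv_mem ha

/-- The projection of the enveloping group to the symmetric group. -/
def toPerm : GA →* Equiv.Perm (Fin 4) :=
  Rack.toEnvelGroup.map
    { toFun := fun i : RackA => (i.1 : Equiv.Perm (Fin 4)), map_act' := rfl }

theorem toPerm_gen (i : RackA) : toPerm (gen i) = i.1 := rfl

theorem gen_injective : Function.Injective gen := fun i j h =>
  Subtype.ext (by rw [← toPerm_gen, ← toPerm_gen, h])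

/-- The conjugation action of the symmetric group on transpositions. -/
def conjRack (σ : Equiv.Perm (Fin 4)) (i : RackA) : RackA :=
  ⟨σ * i.1 * σ⁻¹, i.2.trans (isConj_iff.2 ⟨σ, rfl⟩)⟩

/-- Conjugation permutes the generators through S₄ alone. It suffices to check this for generators,
where it is the defining relation. -/
theorem conj_gen (g : GA) (i : RackA) :
    g * gen i * g⁻¹ = gen (conjRack (toPerm g) i) := by
  have hg : g ∈ Subgroup.closure (Set.range gen) := by
    rw [closure_range_gen]; trivial
  induction hg using Subgroup.closure_induction generalizing i with
  | mem g hg =>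
    obtain ⟨j, rfl⟩ := hg
    rw [← gen_act]
    rfl
  | one =>
    have : conjRack (toPerm 1) i = i := Subtype.ext (by simp [conjRack])
    rw [this]; simp
  | mul g h _ _ hg hh =>
    have : conjRack (toPerm (g * h)) i = conjRack (toPerm g) (conjRack (toPerm h) i) :=
      Subtype.ext (by simp [conjRack, mul_assoc])
    rw [this, ← hg, ← hh]
    group
  | inv g _ hg =>
    have : i = conjRack (toPerm g) (conjRack (toPerm g⁻¹) i) :=
      Subtype.ext (by simp [conjRack, mul_assoc])
    nth_rewrite 1 [this]
    rw [← hg]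
    group

/-- An element over the identity permutation fixes every generator under conjugation, hence is
central. -/
theorem commute_of_toPerm_eq_one {g : GA} (hg : toPerm g = 1) (h : GA) : Commute g h := by
  have hh : h ∈ Subgroup.closure (Set.range gen) := by
    rw [closure_range_gen]; trivial
  induction hh using Subgroup.closure_induction with
  | mem h hh =>
    obtain ⟨j, rfl⟩ := hh
    have := conj_gen g j
    have e : conjRack (toPerm g) j = j := Subtype.ext (by simp [conjRack, hg])
    rw [e, mul_inv_eq_iff_eq_mul] at this
    exact this
  | one => exact Commute.one_right g
  | mul a b _ _ ha hb => exact ha.mul_right hb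
  | inv a _ ha => exact ha.inv_right

/-- Modulo central elements the centralizer of x₁ is represented by 1, x₁, x₄ and x₁x₄, which
commute with each other. -/
theorem centralizer_commute {g h : GA} (hg : g ∈ Subgroup.centralizer {gen π₁})
    (hh : h ∈ Subgroup.centralizer {gen π₁}) : Commute g h := by
  have comm : ∀ w w' : GA, w ∈ ({1, gen π₁, gen π₄, gen π₁ * gen π₄} : Set GA) →
      w' ∈ ({1, gen π₁, gen π₄, gen π₁ * gen π₄} : Set GA) → Commute w w' := by
    have h14 : Commute (gen π₁) (gen π₄) :=
      (Subgroup.mem_centralizer_singleton_iff.1 gen₄_mem).symm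
    have hs : ∀ w ∈ ({1, gen π₁, gen π₄, gen π₁ * gen π₄} : Set GA),
        Commute w (gen π₁) ∧ Commute w (gen π₄) := by
      rintro w (rfl | rfl | rfl | rfl)
      · exact ⟨Commute.one_left _, Commute.one_left _⟩
      · exact ⟨Commute.refl _, h14⟩
      · exact ⟨h14.symm, Commute.refl _⟩
      · exact ⟨(Commute.refl _).mul_left h14.symm, h14.mul_left (Commute.refl _)⟩
    rintro w w' hw (rfl | rfl | rfl | rfl)
    · exact Commute.one_right _
    · exact (hs w hw).1
    · exact (hs w hw).2
    · exact (hs w hw).1.mul_right (hs w hw).2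
  have split : ∀ g ∈ Subgroup.centralizer {gen π₁}, ∃ z w : GA, toPerm z = 1 ∧
      w ∈ ({1, gen π₁, gen π₄, gen π₁ * gen π₄} : Set GA) ∧ g = z * w := by
    intro g hg
    have hperm : ∀ σ : Equiv.Perm (Fin 4), σ * π₁.1 = π₁.1 * σ →
        σ = 1 ∨ σ = π₁.1 ∨ σ = π₄.1 ∨ σ = π₁.1 * π₄.1 := by decide
    have h1 := congrArg toPerm (Subgroup.mem_centralizer_singleton_iff.1 hg)
    rw [map_mul, map_mul, toPerm_gen] at h1
    rcases hperm _ h1 with h | h | h | h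
    · exact ⟨g, 1, h, by simp, by simp⟩
    · exact ⟨g * (gen π₁)⁻¹, gen π₁, by simp [h, toPerm_gen], by simp, by simp⟩
    · exact ⟨g * (gen π₄)⁻¹, gen π₄, by simp [h, toPerm_gen], by simp, by simp⟩
    · exact ⟨g * (gen π₁ * gen π₄)⁻¹, gen π₁ * gen π₄, by simp [h, toPerm_gen], by simp, by group⟩
  obtain ⟨z, w, hz, hw, rfl⟩ := split g hg
  obtain ⟨z', w', hz', hw', rfl⟩ := split h hh
  exact (commute_of_toPerm_eq_one hz _).mul_left
    ((commute_of_toPerm_eq_one hz' w).symm.mul_right (comm w w' hw hw'))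

/-- Transpositions are involutions, so x_j² commutes with every x_i; conjugating by x_i then gives
x_{i▷j}² = x_j². All transpositions are conjugate, so all these squares agree. -/
theorem xgen_sq (i j : Letter) : xgen i * xgen i = xgen j * xgen j := by
  have hstep : ∀ i j : Letter, xgen (Letter.act i j) * xgen (Letter.act i j) =
      xgen j * xgen j := by
    intro i j
    have h1 := xgen_mul i j
    have h2 : xgen j * (xgen j * xgen i) = xgen i * xgen j * xgen j := by
      rw [xgen_mul j i, ← mul_assoc, xgen_mul j, Letter.act_act, mul_assoc]
    refine mul_right_cancel (b := xgen i) ?_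
    rw [mul_assoc, ← h1, ← mul_assoc, ← h1, mul_assoc, ← mul_assoc, ← h2, mul_assoc]
  have h : ∀ j, xgen j * xgen j = xgen l₁ * xgen l₁ := by
    intro j
    cases j
    · rfl
    · exact hstep l₃ l₁
    · exact hstep l₂ l₁
    · exact (hstep l₃ l₆).trans (hstep l₅ l₁)
    · exact hstep l₆ l₁
    · exact hstep l₅ l₁
  rw [h i, h j]

/-! ### Normalising the coefficients -/

/-- A cocycle on the rack of transpositions is determined by its values on a spanning tree. -/
theorem eq_signTable {k : Type*} [Field k] {s : k} (hs : s * s = 1) (q : Letter → Letter → k)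
    (hself : ∀ i, q i i = -1) (sq : ∀ i j, q i j * q i (act i j) = 1)
    (co : ∀ i j l, q i (act j l) * q j l = q (act i j) (act i l) * q i l)
    (h21 : q l₂ l₁ = s) (h31 : q l₃ l₁ = -1) (h41 : q l₄ l₁ = s) (h51 : q l₅ l₁ = s)
    (h61 : q l₆ l₁ = -1) (h36 : q l₃ l₆ = s) (i j : Letter) : q i j = signTable s i j := by
  have h11 := hself l₁
  have h22 := hself l₂
  have h33 := hself l₃
  have h44 := hself l₄
  have h55 := hself l₅
  have h66 := hself l₆
  -- Each further entry is the only unknown in one instance of `sq` or `co`, and is solved for with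
  -- s² = 1.
  have h23 : q l₂ l₃ = s := by
    have h : q l₂ l₃ * q l₂ l₁ = 1 := sq l₂ l₃
    rw [h21] at h
    linear_combination (s) * h + (0 - q l₂ l₃) * hs
  have h32 : q l₃ l₂ = -1 := by
    have h : q l₃ l₂ * q l₃ l₁ = 1 := sq l₃ l₂
    rw [h31] at h
    linear_combination (-1) * h + (0) * hs
  have h34 : q l₃ l₄ = s := by
    have h : q l₃ l₄ * q l₃ l₆ = 1 := sq l₃ l₄
    rw [h36] at h
    linear_combination (s) * h + (0 - q l₃ l₄) * hs
  have h56 : q l₅ l₆ = s := by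
    have h : q l₅ l₆ * q l₅ l₁ = 1 := sq l₅ l₆
    rw [h51] at h
    linear_combination (s) * h + (0 - q l₅ l₆) * hs
  have h65 : q l₆ l₅ = -1 := by
    have h : q l₆ l₅ * q l₆ l₁ = 1 := sq l₆ l₅
    rw [h61] at h
    linear_combination (-1) * h + (0) * hs
  have h13 : q l₁ l₃ = s := by
    have h : q l₁ l₃ * q l₂ l₁ = q l₃ l₁ * q l₁ l₁ := co l₁ l₂ l₁
    rw [h11, h21, h31] at h
    linear_combination (s) * h + (0 - q l₁ l₃) * hs
  have h12 : q l₁ l₂ = s := by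
    have h : q l₁ l₂ * q l₃ l₁ = q l₂ l₁ * q l₁ l₁ := co l₁ l₃ l₁
    rw [h11, h21, h31] at h
    linear_combination (-1) * h + (0) * hs
  have h16 : q l₁ l₆ = s := by
    have h : q l₁ l₆ * q l₅ l₁ = q l₆ l₁ * q l₁ l₁ := co l₁ l₅ l₁
    rw [h11, h51, h61] at h
    linear_combination (s) * h + (0 - q l₁ l₆) * hs
  have h15 : q l₁ l₅ = s := by
    have h : q l₁ l₅ * q l₆ l₁ = q l₅ l₁ * q l₁ l₁ := co l₁ l₆ l₁
    rw [h11, h51, h61] at h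
    linear_combination (-1) * h + (0) * hs
  have h53 : q l₅ l₃ = s := by
    have h : q l₂ l₁ * q l₄ l₁ = q l₅ l₃ * q l₂ l₁ := co l₂ l₄ l₁
    rw [h21, h41] at h
    linear_combination (-s) * h + (s - q l₅ l₃) * hs
  have h62 : q l₆ l₂ = s := by
    have h : q l₃ l₁ * q l₄ l₁ = q l₆ l₂ * q l₃ l₁ := co l₃ l₄ l₁
    rw [h31, h41] at h
    linear_combination (1) * h + (0) * hs
  have h52 : q l₅ l₂ = -1 := by
    have h : q l₃ l₆ * q l₅ l₁ = q l₅ l₂ * q l₃ l₁ := co l₃ l₅ l₁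
    rw [h31, h36, h51] at h
    linear_combination (1) * h + (-1) * hs
  have h54 : q l₅ l₄ = -1 := by
    have h : q l₃ l₂ * q l₅ l₄ = q l₅ l₆ * q l₃ l₄ := co l₃ l₅ l₄
    rw [h32, h34, h56] at h
    linear_combination (-1) * h + (-1) * hs
  have h43 : q l₄ l₃ = s := by
    have h : q l₄ l₃ * q l₂ l₁ = q l₅ l₁ * q l₄ l₁ := co l₄ l₂ l₁
    rw [h21, h41, h51] at h
    linear_combination (s) * h + (s - q l₄ l₃) * hs
  have h42 : q l₄ l₂ = s := by
    have h : q l₄ l₂ * q l₃ l₁ = q l₆ l₁ * q l₄ l₁ := co l₄ l₃ l₁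
    rw [h31, h41, h61] at h
    linear_combination (-1) * h + (0) * hs
  have h46 : q l₄ l₆ = s := by
    have h : q l₄ l₆ * q l₅ l₁ = q l₂ l₁ * q l₄ l₁ := co l₄ l₅ l₁
    rw [h21, h41, h51] at h
    linear_combination (s) * h + (s - q l₄ l₆) * hs
  have h25 : q l₂ l₅ = s := by
    have h : q l₄ l₄ * q l₅ l₂ = q l₂ l₅ * q l₄ l₂ := co l₄ l₅ l₂
    rw [h42, h44, h52] at h
    linear_combination (-s) * h + (0 - q l₂ l₅) * hs
  have h26 : q l₂ l₆ = s := by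
    have h : q l₄ l₃ * q l₅ l₃ = q l₂ l₆ * q l₄ l₃ := co l₄ l₅ l₃
    rw [h43, h53] at h
    linear_combination (-s) * h + (s - q l₂ l₆) * hs
  have h24 : q l₂ l₄ = s := by
    have h : q l₄ l₂ * q l₅ l₄ = q l₂ l₄ * q l₄ l₄ := co l₄ l₅ l₄
    rw [h42, h44, h54] at h
    linear_combination (1) * h + (0) * hs
  have h45 : q l₄ l₅ = s := by
    have h : q l₄ l₅ * q l₆ l₁ = q l₃ l₁ * q l₄ l₁ := co l₄ l₆ l₁
    rw [h31, h41, h61] at h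
    linear_combination (-1) * h + (0) * hs
  have h35 : q l₃ l₅ = s := by
    have h : q l₄ l₂ * q l₆ l₂ = q l₃ l₅ * q l₄ l₂ := co l₄ l₆ l₂
    rw [h42, h62] at h
    linear_combination (-s) * h + (s - q l₃ l₅) * hs
  have h63 : q l₆ l₃ = -1 := by
    have h : q l₄ l₄ * q l₆ l₃ = q l₃ l₆ * q l₄ l₃ := co l₄ l₆ l₃
    rw [h36, h43, h44] at h
    linear_combination (-1) * h + (-1) * hs
  have h64 : q l₆ l₄ = -1 := by
    have h : q l₄ l₃ * q l₆ l₄ = q l₃ l₄ * q l₄ l₄ := co l₄ l₆ l₄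
    rw [h34, h43, h44] at h
    linear_combination (s) * h + (-1 - q l₆ l₄) * hs
  have h14 : q l₁ l₄ = s := by
    have h : q l₅ l₄ * q l₁ l₄ = q l₆ l₂ * q l₅ l₄ := co l₅ l₁ l₄
    rw [h54, h62] at h
    linear_combination (-1) * h + (0) * hs
  cases i <;> cases j <;> assumption

/-! ### A basis of the induced module -/

section Induced

variable {k W : Type*} [Field k] [AddCommGroup W] [Module k W]
  (ρ : Representation k (Subgroup.centralizer {gen π₁}) W)

/-- Elements of the enveloping group that conjugate `x₁` to the generators. -/
def cosetRep : Letter → GA :=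
  table 1 (xgen l₃) (xgen l₂) (xgen l₃ * xgen l₅) (xgen l₆) (xgen l₅)

theorem cosetRep_conj (i : Letter) : cosetRep i * gen π₁ * (cosetRep i)⁻¹ = xgen i := by
  have h : ∀ i j : Letter, xgen i * xgen j * (xgen i)⁻¹ = xgen (Letter.act i j) := fun i j => by
    rw [xgen_mul]; group
  change cosetRep i * xgen l₁ * (cosetRep i)⁻¹ = xgen i
  cases i
  · simp [cosetRep, table]
  · exact h l₃ l₁
  · exact h l₂ l₁
  · change xgen l₃ * xgen l₅ * xgen l₁ * (xgen l₃ * xgen l₅)⁻¹ = xgen l₄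
    have h1 : xgen l₃ * xgen l₅ * xgen l₁ * (xgen l₃ * xgen l₅)⁻¹ =
        xgen l₃ * (xgen l₅ * xgen l₁ * (xgen l₅)⁻¹) * (xgen l₃)⁻¹ := by group
    rw [h1, h l₅ l₁]
    exact h l₃ l₆
  · exact h l₆ l₁
  · exact h l₅ l₁

theorem xgen_injective : Function.Injective xgen := by
  intro i j h
  have h' := congrArg Subtype.val (gen_injective h)
  clear h
  revert i j
  decide

variable {ρ} {χ : Subgroup.centralizer {gen π₁} →* kˣ} (hχ : ∀ c w, ρ c w = (χ c : k) • w)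

include hχ

/-- A functional `l` on `W` extends to the induced module. -/
theorem exists_functional (l : W →ₗ[k] k) :
    ∃ F : InducedSpace (gen π₁) ρ →ₗ[k] k, ∀ w, F (inducedTmul (gen π₁) ρ 1 w) = l w := by
  classical
  -- The functional is supported on the coset of 1; the inverse character makes it invariant under
  -- the centralizer, hence defined on coinvariants.
  let coef : GA → k := fun h =>
    if hh : h ∈ Subgroup.centralizer {gen π₁} then ((χ ⟨h, hh⟩)⁻¹ : kˣ) else 0
  have hcoef : ∀ (c : Subgroup.centralizer {gen π₁}) (h : GA),
      coef (c * h) * (χ c : k) = coef h := by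
    intro c h
    by_cases hh : h ∈ Subgroup.centralizer {gen π₁}
    · have hh' : (c : GA) * h ∈ Subgroup.centralizer {gen π₁} := mul_mem c.2 hh
      have e : (⟨(c : GA) * h, hh'⟩ : Subgroup.centralizer {gen π₁}) = c * ⟨h, hh⟩ := rfl
      simp only [coef, dif_pos hh, dif_pos hh', e, map_mul]
      rw [← Units.val_mul]
      congr 1
      rw [mul_inv_rev, mul_assoc, inv_mul_cancel, mul_one]
    · have hh' : ¬ (c : GA) * h ∈ Subgroup.centralizer {gen π₁} := fun h' =>
        hh (by simpa using mul_mem (inv_mem c.2) h')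
      simp [coef, dif_neg hh, dif_neg hh']
  refine ⟨Representation.Coinvariants.lift _
    (TensorProduct.lift ((Finsupp.lsum k fun h : GA => LinearMap.toSpanSingleton k
        (W →ₗ[k] k) (coef h • l)) ∘ₗ
      (MonoidAlgebra.coeffLinearEquiv k).toLinearMap)) ?_, fun w => ?_⟩
  · intro c
    refine TensorProduct.ext' fun a w => ?_
    induction a using MonoidAlgebra.induction_linear with
    | zero => simp
    | add a b ha hb => rw [TensorProduct.add_tmul, map_add, map_add, ha, hb]
    | single h r =>
      have := hcoef c h
      simp only [LinearMap.coe_comp, Function.comp_apply,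
        Representation.tprod_apply, TensorProduct.map_tmul, MonoidHom.coe_comp,
        Subgroup.coe_subtype, TensorProduct.lift.tmul, hχ]
      simp
      rw [← this]
      ring
  · have : coef 1 = 1 := by
      have h1 : (1 : GA) ∈ Subgroup.centralizer {gen π₁} := one_mem _
      have e : (⟨1, h1⟩ : Subgroup.centralizer {gen π₁}) = 1 := rfl
      simp only [coef, dif_pos h1, e, map_one, inv_one, Units.val_one]
    simp [inducedTmul, this]

theorem inducedTmul_ne_zero {w : W} (hw : w ≠ 0) (h : GA) : inducedTmul (gen π₁) ρ h w ≠ 0 := by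
  intro h0
  have h1 : inducedTmul (gen π₁) ρ 1 w = 0 := by
    have := induced_rep_tmul (gen π₁) ρ h⁻¹ h w
    rwa [h0, map_zero, inv_mul_cancel, eq_comm] at this
  obtain ⟨l, hl⟩ : ∃ l : W →ₗ[k] k, l w ≠ 0 := by
    by_contra! hall
    exact hw ((Module.forall_dual_apply_eq_zero_iff k w).1 hall)
  obtain ⟨F, hF⟩ := exists_functional hχ l
  exact hl (by rw [← hF, h1, map_zero])

omit hχ in
theorem component_inducedTmul (i : Letter) (w : W) :
    inducedTmul (gen π₁) ρ (cosetRep i) w ∈ (induced (gen π₁) ρ).component (xgen i) := by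
  rw [YetterDrinfeld.mem_component, induced_coact_tmul, cosetRep_conj]

omit hχ in
theorem cosetRep_mem {h : GA} {i : Letter} (hi : h * gen π₁ * h⁻¹ = xgen i) :
    (cosetRep i)⁻¹ * h ∈ Subgroup.centralizer {gen π₁} := by
  rw [Subgroup.mem_centralizer_singleton_iff]
  have := hi.trans (cosetRep_conj i).symm
  rw [mul_inv_eq_iff_eq_mul] at this
  rw [mul_assoc, this]
  group

omit hχ in
theorem xgen_mul_cosetRep_conj (i j : Letter) :
    (xgen i * cosetRep j) * gen π₁ * (xgen i * cosetRep j)⁻¹ = xgen (act i j) := by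
  have h1 := cosetRep_conj j
  have h2 := xgen_mul i j
  rw [← h1] at h2
  rw [← mul_inv_eq_iff_eq_mul] at h2
  rw [← h2]
  group

omit hχ in
theorem exists_conj_eq_xgen (h : GA) : ∃ i, h * gen π₁ * h⁻¹ = xgen i := by
  obtain ⟨i, hi⟩ := toRack_surjective (conjRack (toPerm h) π₁)
  exact ⟨i, by rw [conj_gen, ← hi]; rfl⟩

/-- The element of the centralizer by which `x_i` acts on the coset representatives. -/
def cosetCocycle (i j : Letter) : Subgroup.centralizer {gen π₁} :=
  ⟨(cosetRep (act i j))⁻¹ * (xgen i * cosetRep j), cosetRep_mem (xgen_mul_cosetRep_conj i j)⟩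

/-- The vectors are independent because they lie in distinct degrees x_i. They span because the
cosets of the centralizer of x₁ correspond to the conjugates of x₁, which are exactly the six
generators. -/
theorem exists_basis (hW : Module.finrank k W = 1) (c : Letter → k) (hc : ∀ i, c i ≠ 0) :
    ∃ (w : W) (b : Module.Basis Letter k (InducedSpace (gen π₁) ρ)),
      ∀ i, b i = c i • inducedTmul (gen π₁) ρ (cosetRep i) w := by
  obtain ⟨w, hw, hspan⟩ := finrank_eq_one_iff'.1 hW
  refine ⟨w, Module.Basis.mk (v := fun i => c i • inducedTmul (gen π₁) ρ (cosetRep i) w) ?_ ?_,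
    fun i => by rw [Module.Basis.mk_apply]⟩
  · rw [Fintype.linearIndependent_iff]
    intro a ha i
    have h1 := congrArg (fun v => (induced (gen π₁) ρ).coact v (xgen i)) ha
    simp only [map_sum, map_smul, Finsupp.coe_finsetSum, Finset.sum_apply, map_zero] at h1
    rw [Finset.sum_eq_single i] at h1
    · rw [(YetterDrinfeld.mem_component _).1 (component_inducedTmul i w)] at h1
      simp only [Finsupp.smul_apply, Finsupp.single_eq_same, Finsupp.zero_apply, smul_smul] at h1
      rcases smul_eq_zero.1 h1 with h | h
      · exact (mul_eq_zero.1 h).resolve_right (hc i)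
      · exact absurd h (inducedTmul_ne_zero hχ hw _)
    · intro j _ hj
      rw [(YetterDrinfeld.mem_component _).1 (component_inducedTmul j w)]
      have : xgen i ≠ xgen j := fun h => hj (xgen_injective h).symm
      simp [Finsupp.single_eq_of_ne this]
    · simp
  · rintro v -
    induction v using induced_induction (gen π₁) ρ with
    | zero => exact zero_mem _
    | add a b ha hb => exact add_mem ha hb
    | mk h w' =>
      obtain ⟨r, rfl⟩ := hspan w'
      -- The inverse appears because `IndV.mk h w` stands for h⁻¹ ⊗ w.
      obtain ⟨i, hi⟩ := exists_conj_eq_xgen h⁻¹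
      have e := inducedTmul_rep (gen π₁) ρ (cosetRep i) ⟨_, cosetRep_mem hi⟩ (r • w)
      rw [hχ] at e
      simp only [mul_inv_cancel_left] at e
      have e' : Representation.IndV.mk (Subgroup.centralizer {gen π₁}).subtype ρ h (r • w) =
          inducedTmul (gen π₁) ρ h⁻¹ (r • w) := by
        rw [inducedTmul, inv_inv]
      rw [e', ← e, map_smul, map_smul]
      have hi : inducedTmul (gen π₁) ρ (cosetRep i) w =
          (c i)⁻¹ • (c i • inducedTmul (gen π₁) ρ (cosetRep i) w) := by
        rw [smul_smul, inv_mul_cancel₀ (hc i), one_smul]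
      rw [hi]
      exact Submodule.smul_mem _ _ (Submodule.smul_mem _ _ (Submodule.smul_mem _ _
        (Submodule.subset_span ⟨i, rfl⟩)))

/-- The induced module has a basis of homogeneous vectors. -/
theorem exists_isLetterBasis (hW : Module.finrank k W = 1) (c : Letter → k)
    (hc : ∀ i, c i ≠ 0) :
    ∃ b : Module.Basis Letter k (InducedSpace (gen π₁) ρ),
      (induced (gen π₁) ρ).IsLetterBasis xgen
        (fun i j => c j * (c (act i j))⁻¹ * (χ (cosetCocycle i j) : k)) b := by
  obtain ⟨w, b, hb⟩ := exists_basis hχ hW c hc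
  refine ⟨b, fun i => ?_, fun i j => ?_⟩
  · rw [hb]
    exact Submodule.smul_mem _ _ (component_inducedTmul i w)
  · rw [hb, hb, map_smul, induced_rep_tmul]
    have e := inducedTmul_rep (gen π₁) ρ (cosetRep (act i j)) (cosetCocycle i j) w
    rw [hχ, map_smul] at e
    simp only [cosetCocycle, mul_inv_cancel_left] at e
    rw [← e, smul_smul, smul_smul]
    congr 1
    rw [mul_assoc, mul_assoc, mul_left_comm (c (act i j))⁻¹, mul_comm (c (act i j))⁻¹,
      mul_inv_cancel₀ (hc _), mul_one]
    rfl

omit hχ in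
theorem cosetCocycle_self (i : Letter) : cosetCocycle i i = c₁ := by
  apply Subtype.ext
  simp only [cosetCocycle, act_self, c₁]
  rw [← cosetRep_conj i]
  group

omit hχ in
-- The coset representatives follow a tree with edges from l₁ to l₂, l₃, l₅, l₆ and from l₆ to l₄.
-- The cocycle is trivial along it, and the remaining datum is the loop given by x₄ at l₁.
theorem cosetCocycle_tree : cosetCocycle l₂ l₁ = 1 ∧ cosetCocycle l₃ l₁ = 1 ∧
    cosetCocycle l₅ l₁ = 1 ∧ cosetCocycle l₆ l₁ = 1 ∧ cosetCocycle l₃ l₆ = 1 ∧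
    cosetCocycle l₄ l₁ = c₄ := by
  refine ⟨?_, ?_, ?_, ?_, ?_, ?_⟩ <;> apply Subtype.ext <;>
    simp [cosetCocycle, act, table, cosetRep, c₄, xgen, toRack]

omit hχ in
theorem c₁_sq : c₁ * c₁ = c₄ * c₄ := Subtype.ext (xgen_sq l₁ l₄)

end Induced

/-! ### Constraints on the coefficients of the action -/

namespace YetterDrinfeld.IsLetterBasis

variable {k V : Type*} [Field k] [AddCommGroup V] [Module k V] {Y : YetterDrinfeld k GA V}
  {q : Letter → Letter → k} {b : Module.Basis Letter k V} (hb : Y.IsLetterBasis xgen q b)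

include hb

theorem coeff_cocycle (i j l : Letter) :
    q i (act j l) * q j l = q (act i j) (act i l) * q i l := by
  have h := congrArg (fun g => Y.rep g (b l)) (xgen_mul i j)
  have e : act (act i j) (act i l) = act i (act j l) := by
    cases i <;> cases j <;> cases l <;> rfl
  simp only [map_mul, Module.End.mul_apply, hb.rep, map_smul, smul_smul, e] at h
  have := congrArg (b.coord (act i (act j l))) h
  simpa [mul_comm] using this

/-- The equality x_i² = x_j² is evaluated on b_j. -/
theorem coeff_sq (i j : Letter) : q i j * q i (act i j) = q j j * q j j := by
  have h := congrArg (fun g => Y.rep g (b j)) (xgen_sq i j)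
  simp only [map_mul, Module.End.mul_apply, hb.rep, map_smul, smul_smul, act_act, act_self] at h
  have := congrArg (b.coord j) h
  simpa using this

end YetterDrinfeld.IsLetterBasis

/-! ### Absolutely simple representations of abelian groups -/

section AbsolutelySimple

variable {k : Type u} [Field k] {W : Type v} [AddCommGroup W] [Module k W]

theorem IsAbsolutelySimple.isIrreducible {C : Type*} [Group C] {ρ : Representation k C W}
    (h : IsAbsolutelySimple ρ) : ρ.IsIrreducible := by
  have hk : IsSimpleOrder (Subrepresentation (baseChangeRep k ρ)) := h k
  have hact : ∀ c (z : k ⊗[k] W),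
      TensorProduct.lid k W (baseChangeRep k ρ c z) = ρ c (TensorProduct.lid k W z) := by
    intro c z
    induction z using TensorProduct.induction_on with
    | zero => simp
    | add a b ha hb => simp only [map_add, ha, hb]
    | tmul a w => simp [baseChangeRep]
  let F : Subrepresentation ρ → Subrepresentation (baseChangeRep k ρ) := fun S =>
    ⟨S.toSubmodule.comap (TensorProduct.lid k W).toLinearMap, fun c z hz => by
      simp only [Submodule.mem_comap, LinearEquiv.coe_coe] at hz ⊢
      rw [hact]
      exact S.apply_mem_toSubmodule c hz⟩
  have hF : ∀ S w, w ∈ S.toSubmodule ↔ (1 : k) ⊗ₜ[k] w ∈ (F S).toSubmodule := by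
    intro S w
    simp [F]
  have hn : Nontrivial W := by
    by_contra hc
    rw [not_nontrivial_iff_subsingleton] at hc
    have : Subsingleton (k ⊗[k] W) := (TensorProduct.lid k W).toEquiv.subsingleton
    refine (bot_ne_top : (⊥ : Subrepresentation (baseChangeRep k ρ)) ≠ ⊤) ?_
    exact Subrepresentation.toSubmodule_injective (Subsingleton.elim _ _)
  refine { exists_pair_ne := ⟨⊥, ⊤, fun e => ?_⟩, eq_bot_or_eq_top := fun S => ?_ }
  · exact bot_ne_top (congrArg Subrepresentation.toSubmodule e)
  · rcases hk.eq_bot_or_eq_top (F S) with e | e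
    · left
      refine Subrepresentation.toSubmodule_injective (Submodule.ext fun w => ?_)
      rw [hF, e]
      change (1 : k) ⊗ₜ[k] w ∈ (⊥ : Submodule k _) ↔ w ∈ (⊥ : Submodule k _)
      rw [Submodule.mem_bot, Submodule.mem_bot,
        ← (TensorProduct.lid k W).map_eq_zero_iff]
      simp
    · right
      refine Subrepresentation.toSubmodule_injective (Submodule.ext fun w => ?_)
      rw [hF, e]
      change (1 : k) ⊗ₜ[k] w ∈ (⊤ : Submodule k _) ↔ w ∈ (⊤ : Submodule k _)
      simp

/-- A simple module over a commutative algebra embeds as a residue field. -/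
theorem exists_equiv_field {C : Type} [CommGroup C] {ρ : Representation k C W}
    (h : ρ.IsIrreducible) : ∃ (L : Type u) (_ : Field L) (_ : Algebra k L) (η : C → L)
    (ψ : W ≃ₗ[k] L), ∀ c w, ψ (ρ c w) = η c * ψ w := by
  have hs := (Representation.irreducible_iff_isSimpleModule_asModule ρ).1 h
  -- Since C lies in `Type`, the residue field lies in the universe of k, the one over which
  -- `IsAbsolutelySimple` quantifies.
  obtain ⟨I, hI, ⟨e⟩⟩ := isSimpleModule_iff_quot_maximal.1 hs
  let : Field (MonoidAlgebra k C ⧸ I) := Ideal.Quotient.field I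
  let e₀ : W ≃+ MonoidAlgebra k C ⧸ I := ρ.asModuleEquiv.symm.toAddEquiv.trans e.toAddEquiv
  have he₀ : ∀ w, e₀ w = e (ρ.asModuleEquiv.symm w) := fun w => rfl
  let ψ : W ≃ₗ[k] MonoidAlgebra k C ⧸ I :=
    { e₀ with
      map_smul' := fun a w => by
        change e₀ (a • w) = a • e₀ w
        rw [he₀, he₀, Representation.asModuleEquiv_symm_map_smul, map_smul, algebraMap_smul] }
  refine ⟨MonoidAlgebra k C ⧸ I, inferInstance, inferInstance,
    fun c => Ideal.Quotient.mk I (MonoidAlgebra.of k C c), ψ, fun c w => ?_⟩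
  change e₀ (ρ c w) = _ * e₀ w
  rw [he₀, he₀, Representation.asModuleEquiv_symm_map_rho, map_smul]
  exact Algebra.smul_def _ _

/-- With W identified with a field L on which C acts by multiplication, base change to L itself. The
multiplication map L ⊗ W → L is equivariant and non-zero, so its kernel is a proper
subrepresentation, hence zero; an injective multiplication map forces dim W = 1. Neither finite
dimension nor an algebraic closure is needed. -/
theorem exists_character_of_commGroup {C : Type} [CommGroup C] {ρ : Representation k C W}
    (h : IsAbsolutelySimple ρ) : ∃ χ : C →* kˣ,
      Module.finrank k W = 1 ∧ ∀ c w, ρ c w = (χ c : k) • w := by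
  have hirr := h.isIrreducible
  obtain ⟨L, _, _, η, ψ, hψ⟩ := exists_equiv_field hirr
  have hL : IsSimpleOrder (Subrepresentation (baseChangeRep L ρ)) := h L
  let μ : L ⊗[k] W →ₗ[L] L := TensorProduct.AlgebraTensorModule.lift
    ((LinearMap.lsmul L (W →ₗ[k] L)).flip ψ.toLinearMap)
  have hμ : ∀ l w, μ (l ⊗ₜ[k] w) = l * ψ w := fun l w => by simp [μ]
  have hμact : ∀ c z, μ (baseChangeRep L ρ c z) = η c * μ z := by
    intro c z
    induction z using TensorProduct.induction_on with
    | zero => simp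
    | add a b ha hb => simp only [map_add, ha, hb, mul_add]
    | tmul a w =>
      change μ (a ⊗ₜ[k] ρ c w) = _
      rw [hμ, hμ, hψ]; ring
  have hμ1 : μ (1 ⊗ₜ[k] ψ.symm 1) = 1 := by simp [hμ]
  let S : Subrepresentation (baseChangeRep L ρ) := ⟨LinearMap.ker μ, fun c z hz => by
    rw [LinearMap.mem_ker] at hz ⊢
    rw [hμact, hz, mul_zero]⟩
  have hker : LinearMap.ker μ = ⊥ := by
    rcases hL.eq_bot_or_eq_top S with e | e
    · exact congrArg Subrepresentation.toSubmodule e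
    · have e' : LinearMap.ker μ = ⊤ := congrArg Subrepresentation.toSubmodule e
      have : (1 : L) ⊗ₜ[k] ψ.symm 1 ∈ LinearMap.ker μ := e' ▸ Submodule.mem_top
      rw [LinearMap.mem_ker, hμ1] at this
      exact absurd this one_ne_zero
  set w₀ := ψ.symm 1 with hw₀
  have hw₀' : ψ w₀ = 1 := by simp [hw₀]
  have hspan : ∀ w, w ∈ Submodule.span k {w₀} := by
    intro w
    have heq : (ψ w) ⊗ₜ[k] w₀ = (1 : L) ⊗ₜ[k] w := by
      refine LinearMap.ker_eq_bot.1 hker ?_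
      rw [hμ, hμ, hw₀', mul_one, one_mul]
    -- A functional that kills w₀ but not w separates the two sides of `heq`.
    by_contra hw
    obtain ⟨f, hf, hf0⟩ := Submodule.exists_le_ker_of_notMem hw
    have h0 : f w₀ = 0 := hf0 (Submodule.mem_span_singleton_self w₀)
    have := congrArg (LinearMap.baseChange L f) heq
    rw [LinearMap.baseChange_tmul, LinearMap.baseChange_tmul, h0, TensorProduct.tmul_zero] at this
    have := congrArg (TensorProduct.rid k L) this.symm
    simp [hf] at this
  have hne : w₀ ≠ 0 := by
    intro e
    rw [e, map_zero] at hw₀'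
    exact zero_ne_one hw₀'
  have hfin : Module.finrank k W = 1 :=
    finrank_eq_one w₀ hne fun w => Submodule.mem_span_singleton.1 (hspan w)
  choose r hr using fun c => Submodule.mem_span_singleton.1 (hspan (ρ c w₀))
  have hscal : ∀ c w, ρ c w = r c • w := by
    intro c w
    obtain ⟨a, rfl⟩ := Submodule.mem_span_singleton.1 (hspan w)
    rw [map_smul, ← hr, smul_comm]
  have inj : ∀ {a b : k}, a • w₀ = b • w₀ → a = b := fun h => smul_left_injective k hne h
  have h1 : r 1 = 1 := inj (by rw [hr, map_one, one_smul, Module.End.one_apply])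
  have hmul : ∀ c d, r (c * d) = r c * r d := fun c d => inj (by
    rw [hr, map_mul, Module.End.mul_apply, hscal d, hscal c, smul_smul, mul_comm])
  let χ : C →* k := { toFun := r, map_one' := h1, map_mul' := hmul }
  exact ⟨χ.toHomUnits, hfin, fun c w => hscal c w⟩

theorem exists_character {C : Type} [inst : Group C] (hC : ∀ c d : C, c * d = d * c)
    {ρ : Representation k C W} (h : IsAbsolutelySimple ρ) : ∃ χ : C →* kˣ,
      Module.finrank k W = 1 ∧ ∀ c w, ρ c w = (χ c : k) • w := by
  -- The commutative structure has to extend the given group structure, so that ρ keeps its type.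
  obtain ⟨inst', rfl⟩ : ∃ inst' : CommGroup C, inst'.toGroup = inst :=
    ⟨{ inst with mul_comm := hC }, rfl⟩
  exact exists_character_of_commGroup h

end AbsolutelySimple

/-! ### Homogeneous vectors, the normalised basis and the degree-two criterion -/

namespace YetterDrinfeld

variable {k G V : Type*} [Field k] [Group G] [AddCommGroup V] [Module k V]
  {Y : YetterDrinfeld k G V}

/-- The degrees x_j are distinct, so the coaction read at x_i isolates the i-th coordinate. -/
theorem IsLetterBasis.exists_eq_smul {x : Letter → G} {q : Letter → Letter → k}
    {b : Module.Basis Letter k V} (hb : Y.IsLetterBasis x q b) (hx : Function.Injective x)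
    {i : Letter} {v : V} (hv : v ∈ Y.component (x i)) : ∃ a : k, v = a • b i := by
  have hb' : ∀ j, Y.coact (b j) = Finsupp.single (x j) (b j) := fun j => hb.mem j
  have h : Y.coact v (x i) = b.repr v i • b i := by
    conv_lhs => rw [← b.sum_repr v]
    rw [map_sum, Finsupp.finsetSum_apply, Finset.sum_eq_single i]
    · rw [map_smul, hb', Finsupp.smul_apply, Finsupp.single_eq_same]
    · intro j _ hj
      rw [map_smul, hb', Finsupp.smul_apply, Finsupp.single_eq_of_ne (fun e => hj (hx e.symm)),
        smul_zero]
    · simp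
  rw [Y.mem_component.1 hv, Finsupp.single_eq_same] at h
  exact ⟨_, h⟩

theorem IsHopfIntegral.smul {Λ : Y.Nichols} (h : Y.IsHopfIntegral Λ) {a : k} (ha : a ≠ 0) :
    Y.IsHopfIntegral (a • Λ) :=
  ⟨smul_ne_zero ha h.1, fun z => by
    rw [mul_smul_comm, smul_mul_assoc, (h.2 z).1, (h.2 z).2, smul_comm]
    exact ⟨rfl, rfl⟩⟩

theorem eval_smul {A : Type*} [Ring A] [Algebra k A] (a : Letter → k) (y : Letter → A)
    (w : List Letter) : eval (fun i => a i • y i) w = (w.map a).prod • eval y w := by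
  induction w with
  | nil => simp [eval]
  | cons i w ih =>
    simp only [eval, List.map_cons, List.prod_cons] at ih ⊢
    rw [ih, smul_mul_smul_comm]

end YetterDrinfeld

section Induced

variable {k : Type*} [Field k] {W : Type*} [AddCommGroup W] [Module k W]
  {ρ : Representation k (Subgroup.centralizer {gen π₁}) W}
  {χ : Subgroup.centralizer {gen π₁} →* kˣ}

theorem character_c₄ (h : (χ c₁ : k) = -1) : (χ c₄ : k) = -1 ∨ (χ c₄ : k) = 1 := by
  have h2 := congrArg (fun c => (χ c : k)) c₁_sq
  simp only [map_mul, Units.val_mul, h] at h2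
  rw [neg_mul_neg, one_mul, eq_comm] at h2
  exact (mul_self_eq_one_iff.1 h2).symm

theorem exists_normalised_basis (hχ : ∀ c w, ρ c w = (χ c : k) • w)
    (hW : Module.finrank k W = 1) (h : (χ c₁ : k) = -1) :
    ∃ s : ℤ, (s = 1 ∨ s = -1) ∧ ∃ b : Module.Basis Letter k (InducedSpace (gen π₁) ρ),
      (induced (gen π₁) ρ).IsLetterBasis xgen (signTable (s : k)) b := by
  obtain ⟨s, hs, hc⟩ : ∃ s : ℤ, (s = 1 ∨ s = -1) ∧ (χ c₄ : k) = s := by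
    rcases character_c₄ h with h' | h'
    · exact ⟨-1, .inr rfl, by simp [h']⟩
    · exact ⟨1, .inl rfl, by simp [h']⟩
  have hss : (s : k) * s = 1 := by rcases hs with rfl | rfl <;> simp
  have hs0 : (s : k) ≠ 0 := left_ne_zero_of_mul_eq_one hss
  have hinv : (s : k)⁻¹ = s := inv_eq_of_mul_eq_one_left hss
  -- Along the tree q_ij is the quotient of the scalars at j and i▷j; these scalars make it equal to
  -- the entry of `signTable` on each tree edge.
  obtain ⟨b, hb⟩ := exists_isLetterBasis hχ hW (table 1 (-1) (s : k) 1 (-1) s)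
    (fun i => by cases i <;> simp [table, hs0])
  have hself : ∀ i, χ (cosetCocycle i i) = χ c₁ := fun i => by rw [cosetCocycle_self]
  obtain ⟨t2, t3, t5, t6, t36, t4⟩ := cosetCocycle_tree
  set q : Letter → Letter → k := fun i j => table 1 (-1) (s : k) 1 (-1) s j *
    (table 1 (-1) (s : k) 1 (-1) s (act i j))⁻¹ * (χ (cosetCocycle i j) : k) with hq
  have hqs : ∀ i, q i i = -1 := fun i => by
    simp only [hq, act_self, cosetCocycle_self, h]
    rw [mul_inv_cancel₀ (by cases i <;> simp [table, hs0]), one_mul]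
  have e : q = signTable (s : k) := by
    funext i j
    refine eq_signTable hss q hqs (fun i j => ?_) hb.coeff_cocycle ?_ ?_ ?_ ?_ ?_ ?_ i j
    · rw [hb.coeff_sq, hqs, neg_mul_neg, one_mul]
    · simp [hq, t2, act, table, hinv]
    · simp [hq, t3, act, table]
    · simp [hq, t4, act, table, hc]
    · simp [hq, t5, act, table, hinv]
    · simp [hq, t6, act, table]
    · simp [hq, t36, act, table]
  exact ⟨s, hs, b, e ▸ hb⟩

theorem finrank_nicholsDegree_two_le_iff (hχ : ∀ c w, ρ c w = (χ c : k) • w)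
    (hW : Module.finrank k W = 1) :
    Module.finrank k ((induced (gen π₁) ρ).nicholsDegree 2) ≤ 21 ↔ (χ c₁ : k) = -1 := by
  constructor
  · intro h
    by_contra hne
    obtain ⟨b, hb⟩ := exists_isLetterBasis hχ hW (fun _ => 1) (fun _ => one_ne_zero)
    have := hb.le_finrank_nicholsDegree_two (fun i => by simpa [cosetCocycle_self] using hne)
    omega
  · intro h
    obtain ⟨s, hs, b, hb⟩ := exists_normalised_basis hχ hW h
    have h2 := congrArg (fun l => l[2]?) count_eq
    simp only [List.getElem?_cons_succ, List.getElem?_cons_zero, Option.some.injEq] at h2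
    rw [hb.finrank_nicholsDegree xgen_mul hs (fun _ _ => rfl), h2]
    omega

end Induced

end NicholsA

end

open NicholsA in
theorem proposition5 {k : Type u} [Field k] {W : Type v} [AddCommGroup W] [Module k W]
    (ρ : Representation k (Subgroup.centralizer {gen π₁}) W) (hρ : IsAbsolutelySimple ρ) :
    -- `ρ` is a linear character `χ`, hence `dim V = 6`
    ∃ χ : Subgroup.centralizer {gen π₁} →* kˣ,
      (Module.finrank k W = 1 ∧ ∀ c w, ρ c w = (χ c : k) • w) ∧
      Module.finrank k (InducedSpace (gen π₁) ρ) = 6 ∧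
      -- the condition on the component of degree two
      (Module.finrank k ((induced (gen π₁) ρ).nicholsDegree 2) ≤
          Module.finrank k (InducedSpace (gen π₁) ρ) *
            (Module.finrank k (InducedSpace (gen π₁) ρ) + 1) / 2 ↔ (χ c₁ : k) = -1) ∧
      ((χ c₁ : k) = -1 → (χ c₄ : k) = -1 ∨ (χ c₄ : k) = 1) ∧
      -- the Nichols algebra in this case
      ((χ c₁ : k) = -1 →
        (induced (gen π₁) ρ).hilbertSeries = qInt 2 ^ 2 * qInt 3 ^ 2 * qInt 4 ^ 2 ∧
        Module.finrank k (induced (gen π₁) ρ).Nichols = 576 ∧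
        ∀ v : RackA → InducedSpace (gen π₁) ρ,
          (∀ i, v i ∈ (induced (gen π₁) ρ).component (gen i) ∧ v i ≠ 0) →
          (induced (gen π₁) ρ).IsHopfIntegral
            (([π₁, π₂, π₁, π₃, π₄, π₂, π₁, π₃, π₄, π₅, π₁, π₆].map
              fun i => (induced (gen π₁) ρ).toNichols (v i)).prod)) := by
  obtain ⟨χ, hW, hχ⟩ := exists_character
    (fun c d => Subtype.ext (centralizer_commute c.2 d.2)) hρ
  have h6 : Module.finrank k (InducedSpace (gen π₁) ρ) = 6 := by
    obtain ⟨b, -⟩ := exists_isLetterBasis hχ hW (fun _ => 1) (fun _ => one_ne_zero)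
    exact Module.finrank_eq_card_basis b
  refine ⟨χ, ⟨hW, hχ⟩, h6, ?_, character_c₄, fun h => ?_⟩
  · rw [h6]
    exact finrank_nicholsDegree_two_le_iff hχ hW
  obtain ⟨s, hs, b, hb⟩ := exists_normalised_basis hχ hW h
  refine ⟨hb.hilbertSeries_eq xgen_mul hs fun _ _ => rfl,
    hb.finrank_nichols xgen_mul hs fun _ _ => rfl, fun v hv => ?_⟩
  -- Each v_i is a non-zero multiple of b_i, so the product changes only by a non-zero scalar.
  choose a ha using fun i : Letter => hb.exists_eq_smul xgen_injective (hv i.toRack).1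
  have ha0 : ∀ i, a i ≠ 0 := fun i h0 => (hv i.toRack).2 (by rw [ha, h0, zero_smul])
  let w : List Letter := [.l₁, .l₂, .l₁, .l₃, .l₄, .l₂, .l₁, .l₃, .l₄, .l₅, .l₁, .l₆]
  have hw : ([π₁, π₂, π₁, π₃, π₄, π₂, π₁, π₃, π₄, π₅, π₁, π₆].map
      fun i => (induced (gen π₁) ρ).toNichols (v i)).prod =
      (w.map a).prod • (induced (gen π₁) ρ).nicholsMon b w := by
    rw [YetterDrinfeld.nicholsMon_eq_eval, ← YetterDrinfeld.eval_smul]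
    simp only [← map_smul, ← ha]
    rfl
  rw [hw]
  refine (hb.isHopfIntegral_nicholsMon xgen_mul hs (fun _ _ => rfl) ?_ rfl).smul ?_
  -- The word contains the leading word l₄l₂ and is not normal, so its rigidity is checked directly.
  · decide +kernel
  · refine List.prod_ne_zero fun h0 => ?_
    obtain ⟨i, -, hi⟩ := List.mem_map.1 h0
    exact ha0 i hi
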